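/- Let $\alpha\in(0,1)$ and let $\psi=(\psi(t),\,t\ge 0)$ be the tempered $\alpha$-stable subordinator, i.e. the subordinator (nonnegative process with $\psi(0)=0$ a.s., independent stationary increments and a.s. nondecreasing right-continuous paths) determined by $$\mathbb E\, e^{-u\psi(1)}=\exp\{1-(1+u)^{\alpha}\},\qquad u\ge 0 .$$ Terminology. Paths live in $\mathbb R_+^{[0,\infty)}$ with its cylindrical $\sigma$-algebra, $\overset{d}{=}$ is equality of laws there, and $x1_{[s,\infty)}$ denotes the path $t\mapsto x1_{\{t\ge s\}}$. The Lévy measure of a nonnegative infinitely divisible process $\xi$ without drift is the unique measure $\nu$ on $\mathbb R_+^{[0,\infty)}$ such that $\mathbb E\exp\{-\sum_i c_i\xi(t_i)\}=\exp\{-\int(1-e^{-\sum_i c_iy(t_i)})\,\nu(dy)\}$ for all finite families $t_i\ge0$, $c_i\ge 0$; $\int (y(t)\wedge 1)\,\nu(dy)<\infty$ for all $t$; and $\nu(A)=\nu_*(A\setminus\{0\})$ for all measurable $A$, where $\nu_*$ is the inner measure; $\nu(F)$ denotes $\int F\,d\nu$. For $a>0$, $(\psi\mid\psi(a)=0)$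 denotes the limit, in finite-dimensional distributions, of $\psi$ conditioned on $\{\psi(a)\le\varepsilon\}$ as $\varepsilon\downarrow0$, and $\mathcal L^{(a)}$ denotes a nonnegative infinitely divisible process such that $$\psi\overset{d}{=}(\psi\mid\psi(a)=0)+\mathcal L^{(a)},$$ the two terms on the right being independent and infinitely divisible. (a4) For every $a>0$, $\mathbb E\psi(a)=\alpha a$. If $G\sim\mathrm{Gamma}(1-\alpha,1)$ and $U$ is uniform on $[0,1]$, with $G$, $U$ and $\psi$ independent, then $r^{(a)}(t):=G1_{[aU,\infty)}(t)$ satisfies $$(\psi(t)+G1_{[aU,\infty)}(t),\ t\ge0)\ \overset{d}{=}\ (\psi(t),\ t\ge0)\ \text{ under }\ \mathbb E\Big[\frac{\psi(a)}{\alpha a};\ \cdot\ \Big].$$ (b4) $\psi$ has a unique Lévy measure $\nu$. If $G$ and $U$ have the laws in (a4), $Y$ is standard exponential, and $G,U,Y$ are independent, then $$\nu(F)=\alpha\,\mathbb E\big[G^{-1}Ye^{UY}F(G1_{[UY,\infty)})\big]$$ for every measurable $F:\mathbb R_+^{[0,\infty)}\to[0,\infty]$; that is, $\nu$ is the law of the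 process $G1_{[UY,\infty)}$ under the measure $\alpha\,G^{-1}Ye^{UY}\,d\mathbb P$. (c4) For every $a>0$, the processes $(\psi\mid\psi(a)=0)$ and $\mathcal L^{(a)}$ exist, are unique in law, and $$(\psi\mid\psi(a)=0)\overset{d}{=}(\psi(t\vee a)-\psi(a),\ t\ge0),\qquad \mathcal L^{(a)}\overset{d}{=}(\psi(t\wedge a),\ t\ge0).$$ Their (unique) Lévy measures $\nu_a$ and $\tilde\nu_a$ are given, for every measurable $F:\mathbb R_+^{[0,\infty)}\to[0,\infty]$, by $$\nu_a(F)=\frac1{|\Gamma(-\alpha)|}\int_a^\infty\!\!\int_0^\infty F(x1_{[s,\infty)})\,x^{-\alpha-1}e^{-x}\,dx\,ds,\qquad \tilde\nu_a(F)=\frac1{|\Gamma(-\alpha)|}\int_0^a\!\!\int_0^\infty F(x1_{[s,\infty)})\,x^{-\alpha-1}e^{-x}\,dx\,ds .$$ -/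

import Mathlib

open MeasureTheory ProbabilityTheory Filter Topology Set
open scoped NNReal ENNReal

/-- Nonnegative functions of time `t ∈ [0, ∞)`; the product (cylindrical) `σ`-algebra is the
one carried by function types. -/
abbrev TimePath : Type := ℝ≥0 → ℝ≥0

/-- The path `x 1_{[s, ∞)}`. -/
noncomputable def stepPath (x s : ℝ≥0) : TimePath :=
  (Ici s).indicator (fun _ => x)

/-- The law of a nonnegative process on path space. -/
noncomputable def pathLaw {Ω : Type*} [MeasurableSpace Ω] (P : Measure Ω)
    (X : ℝ≥0 → Ω → ℝ≥0) : Measure TimePath :=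
  P.map (fun ω t => X t ω)

/-- A subordinator: a process started at `0` with independent and stationary increments whose
paths are almost surely nondecreasing and right-continuous (left limits are then automatic). -/
structure IsSubordinator {Ω : Type*} [MeasurableSpace Ω] (P : Measure Ω)
    (ψ : ℝ≥0 → Ω → ℝ≥0) : Prop where
  measurable : ∀ t, Measurable (ψ t)
  zero : ∀ᵐ ω ∂P, ψ 0 ω = 0
  indep : HasIndepIncrements (fun t ω => (ψ t ω : ℝ)) P
  stationary : ∀ s t, IdentDistrib (fun ω => (ψ (s + t) ω : ℝ) - ψ s ω)
    (fun ω => (ψ t ω : ℝ)) P P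
  paths : ∀ᵐ ω ∂P, Monotone (fun t => ψ t ω) ∧
    ∀ t, ContinuousWithinAt (fun t => ψ t ω) (Ici t) t

/-- The tempered `α`-stable subordinator normalized by
`E exp (-u ψ(1)) = exp (1 - (1 + u) ^ α)`. -/
structure IsTemperedStableSubordinator {Ω : Type*} [MeasurableSpace Ω] (P : Measure Ω)
    (α : ℝ) (ψ : ℝ≥0 → Ω → ℝ≥0) : Prop extends IsSubordinator P ψ where
  laplace : ∀ u : ℝ, 0 ≤ u →
    ∫ ω, Real.exp (-u * ψ 1 ω) ∂P = Real.exp (1 - (1 + u) ^ α)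

/-- `ν` is the Lévy measure of a nonnegative infinitely divisible driftless process with law
`μ`. The last field says `ν A = ν_* (A \ {0})`, where `ν_*` is the inner measure. -/
structure IsLevyMeasure (μ ν : Measure TimePath) : Prop where
  laplace : ∀ (I : Finset ℝ≥0) (c : ℝ≥0 → ℝ≥0),
    ∫ y, Real.exp (-∑ t ∈ I, (c t : ℝ) * y t) ∂μ =
      Real.exp (-∫ y, (1 - Real.exp (-∑ t ∈ I, (c t : ℝ) * y t)) ∂ν)
  lintegral_lt_top : ∀ t, ∫⁻ y, (min (y t) 1 : ℝ≥0) ∂ν < ∞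
  inner : ∀ A : Set TimePath, MeasurableSet A →
    ν A = ⨆ (B : Set TimePath) (_ : MeasurableSet B) (_ : B ⊆ A \ {0}), ν B

/-- A probability law on path space is infinitely divisible if each finite-dimensional marginal
is, for every `n ≥ 1`, the law of a sum of `n` independent identically distributed vectors. -/
def IsInfDivLaw (μ : Measure TimePath) : Prop :=
  IsProbabilityMeasure μ ∧ ∀ (I : Finset ℝ≥0) (n : ℕ), 1 ≤ n →
    ∃ ρ : Measure (I → ℝ), IsProbabilityMeasure ρ ∧
      μ.map (fun y (t : I) => (y t : ℝ)) =
        (Measure.pi (fun _ : Fin n => ρ)).map (fun x => ∑ k, x k)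

/-- `κ` is the law of `(ψ | ψ(a) = 0)`, where `ψ` has law `μ`: the limit, in the sense of
finite-dimensional distributions, of the law of `ψ` given `ψ(a) ≤ ε` as `ε ↓ 0`. (If
`ψ(a) = 0` has positive probability this is the elementary conditional law.) -/
def IsCondLawAtZero (μ : Measure TimePath) (a : ℝ≥0) (κ : Measure TimePath) : Prop :=
  IsProbabilityMeasure κ ∧ ∀ (I : Finset ℝ≥0) (f : BoundedContinuousFunction (I → ℝ≥0) ℝ),
    Tendsto (fun ε : ℝ≥0 => ∫ y, f (I.restrict y) ∂(μ[|{y : TimePath | y a ≤ ε}]))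
      (𝓝[>] 0) (𝓝 (∫ y, f (I.restrict y) ∂κ))

/-- `η` is the law of the component `𝓛^{(a)}` in `ψ = (ψ | ψ(a) = 0) + 𝓛^{(a)}` (in law), a sum
of two independent infinitely divisible nonnegative processes, where `ψ` has law `μ`. -/
def IsComplementLaw (μ : Measure TimePath) (a : ℝ≥0) (η : Measure TimePath) : Prop :=
  IsInfDivLaw η ∧ ∃ κ : Measure TimePath, IsCondLawAtZero μ a κ ∧ IsInfDivLaw κ ∧
    (κ.prod η).map (fun p => p.1 + p.2) = μ

/-- `|Γ(-α)|⁻¹ ∫_S ∫_0^∞ F(x 1_{[s, ∞)}) x^{-α-1} e^{-x} dx ds`. -/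
noncomputable def temperedJumpIntegral (α : ℝ) (S : Set ℝ) (F : TimePath → ℝ≥0∞) : ℝ≥0∞ :=
  ENNReal.ofReal (1 / |Real.Gamma (-α)|) *
    ∫⁻ s in S, ∫⁻ x in Ioi (0 : ℝ),
      F (stepPath x.toNNReal s.toNNReal) * ENNReal.ofReal (x ^ (-α - 1) * Real.exp (-x))

/-! Every law on path space is identified by its Laplace functional, the integral of `exp (-∑ c(t)
y(t))`. For `ψ`, independence and stationarity of the increments give `exp (-∫ φ(C(s)) ds)` over
`(0, ∞)`, where `φ(u) = (1 + u) ^ α - 1` is `temperedExponent` and `C(s)`, the sum of the `c(t)`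
with `t ≥ s`, is `tailWeight`. Since `φ(u)` is the integral of `1 - e ^ (-ux)` against `|Γ(-α)|⁻¹ x
^ (-α - 1) e ^ (-x) dx`, this is the exponent of jumps of size `x` at times `s`, so the Lévy measure
is an image of a product measure (`isLevyMeasure_temperedLevyMeasure`); it is unique by
`IsLevyMeasure.unique`.

The path stopped at `a` and the increments after `a` are independent, and the exponent splits over
`(0, a]` and `(a, ∞)`. Conditioning on `ψ(a) ≤ ε` affects only the stopped path, which monotonicity
squeezes to `0`; the later increments remain. Cancelling their positive Laplace functional
identifies the complement as the stopped path. The roots needed for infinite divisibility come from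
slowing the clock.

Size-biasing by `ψ(a)` is minus the derivative of the Laplace functional in the weight of `a`. It
multiplies the functional by `∫₀ᵃ α (1 + C(x)) ^ (α - 1) dx`. As `(1 + u) ^ (α - 1)` is the Laplace
transform of `Gamma(1 - α, 1)`, this is `α a` times the functional of an independent step with
uniform jump time.

For the representation of the Lévy measure, the weight `Y e ^ (UY)` turns the law of `UY` into
Lebesgue measure, and `G⁻¹` turns the Gamma density into the jump density up to a constant. -/

/-! ### Laplace transforms determine finite measures on `[0, ∞)^ι`. -/

section LaplaceUniqueness

open BoundedContinuousFunction

/-- The bounded continuous function `y ↦ exp (-∑ i, c i * y i)` on `ι → ℝ≥0`. -/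
noncomputable def laplaceKernel {ι : Type*} [Fintype ι] (c : ι → ℝ≥0) :
    BoundedContinuousFunction (ι → ℝ≥0) ℝ :=
  BoundedContinuousFunction.ofNormedAddCommGroup
    (fun y => Real.exp (-∑ i, (c i : ℝ) * y i)) (by fun_prop) 1 (fun y => by
      rw [Real.norm_eq_abs, Real.abs_exp, Real.exp_le_one_iff, neg_nonpos]
      positivity)

@[simp]
lemma laplaceKernel_apply {ι : Type*} [Fintype ι] (c y : ι → ℝ≥0) :
    laplaceKernel c y = Real.exp (-∑ i, (c i : ℝ) * y i) := rfl

lemma laplaceKernel_mul {ι : Type*} [Fintype ι] (c d : ι → ℝ≥0) :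
    laplaceKernel c * laplaceKernel d = laplaceKernel (c + d) := by
  ext y
  simp only [BoundedContinuousFunction.coe_mul, Pi.mul_apply, laplaceKernel_apply, ← Real.exp_add,
    Pi.add_apply, NNReal.coe_add, add_mul, Finset.sum_add_distrib, neg_add]

lemma laplaceKernel_zero {ι : Type*} [Fintype ι] :
    laplaceKernel (0 : ι → ℝ≥0) = 1 := by
  ext y
  simp

/-- The exponentials `laplaceKernel c` form a multiplicative submonoid. -/
noncomputable def laplaceSubmonoid (ι : Type*) [Fintype ι] :
    Submonoid (BoundedContinuousFunction (ι → ℝ≥0) ℝ) where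
  carrier := Set.range laplaceKernel
  mul_mem' := by
    rintro _ _ ⟨c, rfl⟩ ⟨d, rfl⟩
    exact ⟨c + d, (laplaceKernel_mul c d).symm⟩
  one_mem' := ⟨0, laplaceKernel_zero⟩

/-- The real algebra generated by the exponentials `laplaceKernel c`. -/
noncomputable def laplaceAlgebra (ι : Type*) [Fintype ι] :
    StarSubalgebra ℝ (BoundedContinuousFunction (ι → ℝ≥0) ℝ) :=
  { Algebra.adjoin ℝ (laplaceSubmonoid ι : Set (BoundedContinuousFunction (ι → ℝ≥0) ℝ)) with
    star_mem' := fun {f} hf => by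
      have : star f = f := by ext; simp
      rwa [this] }

/-- Finite measures on `[0, ∞)^ι` are determined by their Laplace transforms. -/
theorem ext_of_laplace_pi {ι : Type*} [Fintype ι] {μ ν : Measure (ι → ℝ≥0)}
    [IsFiniteMeasure μ] [IsFiniteMeasure ν]
    (h : ∀ c : ι → ℝ≥0, ∫ y, Real.exp (-∑ i, (c i : ℝ) * y i) ∂μ =
      ∫ y, Real.exp (-∑ i, (c i : ℝ) * y i) ∂ν) : μ = ν := by
  classical
  refine ext_of_forall_mem_subalgebra_integral_eq_of_pseudoEMetric_complete_countable
    (A := laplaceAlgebra ι) ?_ ?_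
  · intro x y hxy
    obtain ⟨i, hi⟩ := Function.ne_iff.1 hxy
    refine ⟨_, ⟨toContinuousMapStarₐ ℝ (laplaceKernel (Pi.single i 1)),
      ⟨_, Algebra.subset_adjoin ⟨_, rfl⟩, rfl⟩, rfl⟩, ?_⟩
    change laplaceKernel (Pi.single i 1) x ≠ laplaceKernel (Pi.single i 1) y
    simpa [Pi.single_apply, apply_ite] using hi
  · intro g hg
    -- The exponentials are closed under multiplication, so the algebra they generate is their
    -- linear span and linearity of the integral suffices.
    have hg' : g ∈ Submodule.span ℝ
        (laplaceSubmonoid ι : Set (BoundedContinuousFunction (ι → ℝ≥0) ℝ)) := by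
      have : g ∈ Algebra.adjoin ℝ
        (laplaceSubmonoid ι : Set (BoundedContinuousFunction (ι → ℝ≥0) ℝ)) := hg
      rwa [← Subalgebra.mem_toSubmodule, Algebra.adjoin_eq_span, Submonoid.closure_eq] at this
    clear hg
    induction hg' using Submodule.span_induction with
    | mem x hx => obtain ⟨c, rfl⟩ := hx; exact h c
    | zero => simp
    | add x y _ _ hx hy =>
      simp only [BoundedContinuousFunction.coe_add, Pi.add_apply]
      rw [integral_add (x.integrable μ) (y.integrable μ),
        integral_add (x.integrable ν) (y.integrable ν), hx, hy]
    | smul r x _ hx =>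
      simp only [BoundedContinuousFunction.coe_smul, integral_smul, hx]
end LaplaceUniqueness

/-! ### Laplace functionals on path space and uniqueness of Lévy measures. -/

section PathLaws

/-- The exponential `exp (-∑_{t ∈ I} c(t) y(t))` of a path. -/
noncomputable def pathExp (I : Finset ℝ≥0) (c : ℝ≥0 → ℝ≥0) (y : TimePath) : ℝ :=
  Real.exp (-∑ t ∈ I, (c t : ℝ) * y t)

@[fun_prop]
lemma measurable_pathExp (I : Finset ℝ≥0) (c : ℝ≥0 → ℝ≥0) : Measurable (pathExp I c) := by
  unfold pathExp
  fun_prop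

lemma pathExp_pos (I : Finset ℝ≥0) (c : ℝ≥0 → ℝ≥0) (y : TimePath) : 0 < pathExp I c y :=
  Real.exp_pos _

lemma pathExp_le_one (I : Finset ℝ≥0) (c : ℝ≥0 → ℝ≥0) (y : TimePath) : pathExp I c y ≤ 1 := by
  rw [pathExp, Real.exp_le_one_iff, neg_nonpos]
  positivity

lemma pathExp_add (I : Finset ℝ≥0) (c : ℝ≥0 → ℝ≥0) (y z : TimePath) :
    pathExp I c (y + z) = pathExp I c y * pathExp I c z := by
  simp only [pathExp, ← Real.exp_add, Pi.add_apply, NNReal.coe_add, mul_add,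
    Finset.sum_add_distrib, neg_add]

/-- Finite measures on path space agree if their finite-dimensional marginals do. -/
theorem ext_of_map_restrict {μ ν : Measure TimePath} [IsFiniteMeasure μ]
    (h : ∀ I : Finset ℝ≥0, μ.map I.restrict = ν.map I.restrict) : μ = ν :=
  IsProjectiveLimit.unique (P := fun I : Finset ℝ≥0 => μ.map I.restrict) (fun _ => rfl)
    (fun I => (h I).symm)

lemma integral_laplace_map_restrict (ρ : Measure TimePath) (I : Finset ℝ≥0) (c : I → ℝ≥0) :
    ∫ y : I → ℝ≥0, Real.exp (-∑ i, (c i : ℝ) * y i) ∂(ρ.map I.restrict) =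
      ∫ y, pathExp I (fun t => if ht : t ∈ I then c ⟨t, ht⟩ else 0) y ∂ρ := by
  rw [integral_map (by fun_prop) (Measurable.aestronglyMeasurable (by fun_prop))]
  refine integral_congr_ae (ae_of_all _ fun y => ?_)
  simp only [pathExp]
  congr 2
  rw [← Finset.sum_coe_sort I]
  simp

/-- Finite measures on path space are determined by their Laplace functionals. -/
theorem ext_of_integral_pathExp {μ ν : Measure TimePath} [IsFiniteMeasure μ] [IsFiniteMeasure ν]
    (h : ∀ I c, ∫ y, pathExp I c y ∂μ = ∫ y, pathExp I c y ∂ν) : μ = ν := by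
  refine ext_of_map_restrict fun I => ?_
  refine ext_of_laplace_pi fun c => ?_
  rw [integral_laplace_map_restrict, integral_laplace_map_restrict, h]

/-- A measurable set of paths is determined by countably many coordinates. -/
lemma exists_countable_coordinates {B : Set TimePath} (hB : MeasurableSet B) :
    ∃ T : Set ℝ≥0, T.Countable ∧ ∀ y z : TimePath, (∀ t ∈ T, y t = z t) → (y ∈ B ↔ z ∈ B) := by
  -- Sets depending on countably many coordinates form a `σ`-algebra; it contains the cylinders,
  -- hence every measurable set.
  let m : MeasurableSpace TimePath :=
    { MeasurableSet' := fun B => ∃ T : Set ℝ≥0, T.Countable ∧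
        ∀ y z : TimePath, (∀ t ∈ T, y t = z t) → (y ∈ B ↔ z ∈ B)
      measurableSet_empty := ⟨∅, countable_empty, by simp⟩
      measurableSet_compl := by
        rintro B ⟨T, hT, h⟩
        exact ⟨T, hT, fun y z hyz => not_congr (h y z hyz)⟩
      measurableSet_iUnion := by
        intro f hf
        choose T hT h using hf
        refine ⟨⋃ n, T n, countable_iUnion hT, fun y z hyz => ?_⟩
        simp only [mem_iUnion]
        exact exists_congr fun n => h n y z fun t ht => hyz t (mem_iUnion.2 ⟨n, ht⟩) }
  have hle : (MeasurableSpace.pi : MeasurableSpace TimePath) ≤ m := by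
    refine iSup_le fun t => ?_
    rintro _ ⟨s, -, rfl⟩
    refine ⟨{t}, countable_singleton t, fun y z hyz => ?_⟩
    simp [hyz t rfl]
  exact hle B hB

lemma measurableSet_coordinate_ne_zero (u : ℝ≥0) : MeasurableSet {y : TimePath | y u ≠ 0} :=
  (measurableSet_eq_fun (measurable_pi_apply u) measurable_const).compl

lemma one_sub_exp_neg_le_mul_min (C x : ℝ) (hC : 0 ≤ C) (hx : 0 ≤ x) :
    1 - Real.exp (-(C * x)) ≤ (C + 1) * min x 1 := by
  rcases le_total x 1 with h | h
  · rw [min_eq_left h]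
    nlinarith [Real.add_one_le_exp (-(C * x))]
  · rw [min_eq_right h]
    nlinarith [Real.exp_pos (-(C * x))]

lemma one_sub_exp_neg_sum_le {ι : Type*} (s : Finset ι) (x : ι → ℝ) (hx : ∀ i, 0 ≤ x i) :
    1 - Real.exp (-∑ i ∈ s, x i) ≤ ∑ i ∈ s, (1 - Real.exp (-x i)) := by
  classical
  induction s using Finset.induction_on with
  | empty => simp
  | insert i s hi ih =>
    rw [Finset.sum_insert hi, Finset.sum_insert hi, neg_add, Real.exp_add]
    have h1 : Real.exp (-x i) ≤ 1 := Real.exp_le_one_iff.2 (by linarith [hx i])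
    have h2 : Real.exp (-∑ i ∈ s, x i) ≤ 1 :=
      Real.exp_le_one_iff.2 (by linarith [Finset.sum_nonneg fun j (_ : j ∈ s) => hx j])
    nlinarith

lemma integrable_min_one {ν : Measure TimePath} {t : ℝ≥0}
    (h : ∫⁻ y, (min (y t) 1 : ℝ≥0) ∂ν < ∞) :
    Integrable (fun y : TimePath => min (y t : ℝ) 1) ν := by
  refine ⟨Measurable.aestronglyMeasurable (by fun_prop), ?_⟩
  rw [hasFiniteIntegral_iff_ofReal (ae_of_all _ fun y => by positivity)]
  convert h using 3 with y
  rw [← ENNReal.ofReal_coe_nnreal]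
  simp

/-- Subadditivity of `1 - e ^ (-x)` reduces the bound to single coordinates, where a multiple of
`y(t) ∧ 1` dominates. -/
lemma integrable_one_sub_pathExp {ν : Measure TimePath}
    (h : ∀ t, ∫⁻ y, (min (y t) 1 : ℝ≥0) ∂ν < ∞) (I : Finset ℝ≥0) (c : ℝ≥0 → ℝ≥0) :
    Integrable (fun y => 1 - pathExp I c y) ν := by
  refine Integrable.mono' (g := fun y => ∑ t ∈ I, ((c t : ℝ) + 1) * min (y t : ℝ) 1)
    (integrable_finsetSum _ fun t _ => (integrable_min_one (h t)).const_mul _)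
    (by fun_prop) (ae_of_all _ fun y => ?_)
  rw [Real.norm_eq_abs, abs_of_nonneg (by linarith [pathExp_le_one I c y])]
  refine (one_sub_exp_neg_sum_le I _ fun t => by positivity).trans ?_
  exact Finset.sum_le_sum fun t _ => one_sub_exp_neg_le_mul_min _ _ (by positivity) (by positivity)

/-- Two path measures integrating `y(t) ∧ 1` with the same Laplace exponents agree on
`{y(u) ≠ 0}`. -/
lemma restrict_ne_zero_eq_of_exponent_eq {ν ν' : Measure TimePath}
    (hν : ∀ t, ∫⁻ y, (min (y t) 1 : ℝ≥0) ∂ν < ∞) (hν' : ∀ t, ∫⁻ y, (min (y t) 1 : ℝ≥0) ∂ν' < ∞)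
    (h : ∀ I c, ∫ y, (1 - pathExp I c y) ∂ν = ∫ y, (1 - pathExp I c y) ∂ν') (u : ℝ≥0) :
    ν.restrict {y | y u ≠ 0} = ν'.restrict {y | y u ≠ 0} := by
  classical
  -- The density `1 - e ^ (-y(u))` makes both measures finite and is positive where `y(u) ≠ 0`, so
  -- it can be divided out there.
  let w : TimePath → ℝ := fun y => 1 - Real.exp (-(y u : ℝ))
  have hw : ∀ y, w y = 1 - pathExp {u} 1 y := fun y => by simp [w, pathExp]
  have hw0 : ∀ y, 0 ≤ w y := fun y => by rw [hw]; linarith [pathExp_le_one {u} 1 y]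
  have hwm : Measurable w := by fun_prop
  let f : TimePath → ℝ≥0∞ := fun y => ENNReal.ofReal (w y)
  have hfm : Measurable f := hwm.ennreal_ofReal
  have hwi : ∀ ρ : Measure TimePath, (∀ t, ∫⁻ y, (min (y t) 1 : ℝ≥0) ∂ρ < ∞) →
      Integrable w ρ := fun ρ hρ => by
    rw [funext hw]; exact integrable_one_sub_pathExp hρ _ _
  have hfin : ∀ ρ : Measure TimePath, (∀ t, ∫⁻ y, (min (y t) 1 : ℝ≥0) ∂ρ < ∞) →
      IsFiniteMeasure (ρ.withDensity f) := fun ρ hρ =>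
    isFiniteMeasure_withDensity_ofReal (hwi ρ hρ).2
  have := hfin ν hν
  have := hfin ν' hν'
  -- Multiplying by `w` adds `1` to the weight of `u`, so the Laplace functional is a difference of
  -- exponents. The weights are cut to `I` because `c u` is arbitrary when `u ∉ I`.
  have hint : ∀ ρ : Measure TimePath, (∀ t, ∫⁻ y, (min (y t) 1 : ℝ≥0) ∂ρ < ∞) → ∀ I c,
      ∫ y, pathExp I c y ∂(ρ.withDensity f) =
        ∫ y, (1 - pathExp (insert u I) (fun t => (if t ∈ I then c t else 0) +
          if t = u then 1 else 0) y) ∂ρ - ∫ y, (1 - pathExp I c y) ∂ρ := by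
    intro ρ hρ I c
    rw [integral_withDensity_eq_integral_toReal_smul hfm (ae_of_all _ fun _ => ENNReal.ofReal_lt_top),
      ← integral_sub (integrable_one_sub_pathExp hρ _ _) (integrable_one_sub_pathExp hρ _ _)]
    refine integral_congr_ae (ae_of_all _ fun y => ?_)
    simp only [f, ENNReal.toReal_ofReal (hw0 y), smul_eq_mul, w]
    have : pathExp (insert u I) (fun t => (if t ∈ I then c t else 0) + if t = u then 1 else 0) y
        = pathExp I c y * Real.exp (-(y u : ℝ)) := by
      simp only [pathExp, ← Real.exp_add, NNReal.coe_add, add_mul, Finset.sum_add_distrib]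
      congr 1
      rw [neg_add]
      congr 2
      · rw [← Finset.sum_subset (Finset.subset_insert u I)
          (f := fun t => ((if t ∈ I then c t else 0 : ℝ≥0) : ℝ) * y t)]
        · exact Finset.sum_congr rfl fun t ht => by simp [ht]
        · intro t _ ht; simp [ht]
      · simp [apply_ite]
    rw [this]; ring
  have heq : ν.withDensity f = ν'.withDensity f :=
    ext_of_integral_pathExp fun I c => by rw [hint ν hν, hint ν' hν', h, h]
  have hS := measurableSet_coordinate_ne_zero u
  have hinv : ∀ ρ : Measure TimePath, ((ρ.withDensity f).restrict {y | y u ≠ 0}).withDensity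
      (fun y => (f y)⁻¹) = ρ.restrict {y | y u ≠ 0} := by
    intro ρ
    rw [restrict_withDensity hS]
    refine withDensity_inv_same hfm ?_ (ae_of_all _ fun _ => ENNReal.ofReal_ne_top)
    refine (ae_restrict_iff' hS).2 (ae_of_all _ fun y (hy : y u ≠ 0) => ?_)
    have : 0 < (y u : ℝ) := by positivity
    simpa [f, w] using this
  rw [← hinv ν, ← hinv ν', heq]

/-- The Lévy measure of a law on path space is unique. -/
theorem IsLevyMeasure.unique {μ ν ν' : Measure TimePath} (h : IsLevyMeasure μ ν)
    (h' : IsLevyMeasure μ ν') : ν = ν' := by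
  have hexp : ∀ I c, ∫ y, (1 - pathExp I c y) ∂ν = ∫ y, (1 - pathExp I c y) ∂ν' := fun I c => by
    have := (h.laplace I c).symm.trans (h'.laplace I c)
    exact neg_injective (Real.exp_injective this)
  ext A hA
  rw [h.inner A hA, h'.inner A hA]
  refine iSup_congr fun B => iSup_congr fun hB => iSup_congr fun hBA => ?_
  obtain ⟨T, hT, hTB⟩ := exists_countable_coordinates hB
  -- `B` omits the zero path and sees only the coordinates in the countable set `T`, so each of its
  -- paths is nonzero somewhere on `T`; on these countably many pieces the two measures agree.
  have hsub : B ⊆ ⋃ u ∈ T, {y : TimePath | y u ≠ 0} := by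
    intro y hy
    by_contra hcon
    simp only [mem_iUnion, mem_ofPred_eq, not_exists, not_not] at hcon
    exact (hBA ((hTB y 0 fun t ht => hcon t ht).1 hy)).2 rfl
  have := (Measure.restrict_biUnion_congr hT).2 fun u _ =>
    restrict_ne_zero_eq_of_exponent_eq h.lintegral_lt_top h'.lintegral_lt_top hexp u
  rw [← Measure.restrict_eq_self _ hsub, ← Measure.restrict_eq_self ν' hsub, this]

end PathLaws

/-! ### Independence of the stopped path and the later increments. -/

section IndependentIncrements

lemma exists_monotone_seq_range (s : Finset ℝ≥0) (hs : s.Nonempty) :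
    ∃ τ : ℕ → ℝ≥0, Monotone τ ∧ ∀ t ∈ s, ∃ k, τ k = t := by
  have hc : 0 < s.card := hs.card_pos
  refine ⟨fun k => s.orderEmbOfFin rfl ⟨min k (s.card - 1), by omega⟩, ?_, ?_⟩
  · intro k l hkl
    refine (s.orderEmbOfFin rfl).monotone ?_
    simp only [Fin.mk_le_mk]
    omega
  · intro t ht
    have : t ∈ Set.range (s.orderEmbOfFin rfl) := by
      rw [Finset.range_orderEmbOfFin]; exact ht
    obtain ⟨k, hk⟩ := this
    refine ⟨k, ?_⟩
    rw [← hk]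
    exact congrArg _ (Fin.ext (min_eq_left (Nat.le_sub_one_of_lt k.2)))

variable {Ω : Type*} [MeasurableSpace Ω] {P : Measure Ω} {ψ : ℝ≥0 → Ω → ℝ≥0}

lemma IsSubordinator.measurable_past (hψ : IsSubordinator P ψ) (a : ℝ≥0) :
    Measurable (fun ω t => ψ (min t a) ω) :=
  measurable_pi_lambda _ fun _ => hψ.measurable _

lemma IsSubordinator.measurable_future (hψ : IsSubordinator P ψ) (a : ℝ≥0) :
    Measurable (fun ω t => ψ (max t a) ω - ψ a ω) :=
  measurable_pi_lambda _ fun _ => (hψ.measurable _).sub (hψ.measurable _)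

/-- A subordinator stopped at time `a` is independent of its increments after `a`. -/
theorem IsSubordinator.indepFun_past_future [IsProbabilityMeasure P]
    (hψ : IsSubordinator P ψ) (a : ℝ≥0) :
    IndepFun (fun ω t => ψ (min t a) ω) (fun ω t => ψ (max t a) ω - ψ a ω) P := by
  classical
  refine IndepFun.process_indepFun_process (fun t => hψ.measurable _)
    (fun t => (hψ.measurable _).sub (hψ.measurable _)) fun I J => ?_
  -- The time `0` lets stopped values be sums of increments, and `a` lets the increments be split at
  -- its index.
  let s : Finset ℝ≥0 := insert 0 (insert a (I.image (min · a) ∪ J.image (max · a)))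
  obtain ⟨τ, hτ, hτs⟩ := exists_monotone_seq_range s ⟨0, by simp [s]⟩
  have hτ0 : τ 0 = 0 := by
    obtain ⟨k, hk⟩ := hτs 0 (by simp [s])
    exact le_antisymm (hk ▸ hτ (Nat.zero_le k)) zero_le
  obtain ⟨m, hm⟩ := hτs a (by simp [s])
  have hI : ∀ t : I, ∃ k, k ≤ m ∧ τ k = min (t : ℝ≥0) a := by
    intro t
    obtain ⟨k, hk⟩ := hτs (min (t : ℝ≥0) a) (by
      simp only [s, Finset.mem_insert, Finset.mem_union, Finset.mem_image]
      exact Or.inr (Or.inr (Or.inl ⟨t, t.2, rfl⟩)))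
    -- An index beyond `m` carries a time at least `a`, which forces the time `a` itself; then `m`
    -- serves.
    rcases le_total k m with h | h
    · exact ⟨k, h, hk⟩
    · exact ⟨m, le_rfl, le_antisymm (hk ▸ hτ h) (hm ▸ min_le_right _ _)⟩
  have hJ : ∀ t : J, ∃ k, m ≤ k ∧ τ k = max (t : ℝ≥0) a := by
    intro t
    obtain ⟨k, hk⟩ := hτs (max (t : ℝ≥0) a) (by
      simp only [s, Finset.mem_insert, Finset.mem_union, Finset.mem_image]
      exact Or.inr (Or.inr (Or.inr ⟨t, t.2, rfl⟩)))
    rcases le_total m k with h | h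
    · exact ⟨k, h, hk⟩
    · exact ⟨m, le_rfl, le_antisymm (hm ▸ le_max_right _ _) (hk ▸ hτ h)⟩
  choose k hkm hk using hI
  choose l hml hl using hJ
  let n := Finset.univ.sup l
  have hln : ∀ t, l t ≤ n := fun t => Finset.le_sup (Finset.mem_univ t)
  have hind := hψ.indep.nat hτ
  have hmeas : ∀ i, Measurable fun ω => (ψ (τ (i + 1)) ω : ℝ) - ψ (τ i) ω := fun i =>
    (hψ.measurable _).coe_nnreal_real.sub (hψ.measurable _).coe_nnreal_real
  -- Both finite-dimensional vectors telescope into sums over disjoint blocks of independent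
  -- increments.
  have hfin := hind.indepFun_finset (Finset.range m) (Finset.Ico m n)
    (by
      rw [Finset.disjoint_left]
      intro i hi hi'
      simp only [Finset.mem_range, Finset.mem_Ico] at hi hi'
      omega) hmeas
  have hcomp := hfin.comp
    (φ := fun x (t : I) => (∑ i : Finset.range m, if (i : ℕ) < k t then x i else 0).toNNReal)
    (ψ := fun x (t : J) => (∑ i : Finset.Ico m n, if (i : ℕ) < l t then x i else 0).toNNReal)
    (measurable_pi_lambda _ fun t => Measurable.real_toNNReal
      (Finset.measurable_fun_sum _ fun i _ => by split_ifs <;> fun_prop))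
    (measurable_pi_lambda _ fun t => Measurable.real_toNNReal
      (Finset.measurable_fun_sum _ fun i _ => by split_ifs <;> fun_prop))
  refine hcomp.congr ?_ ?_
  · filter_upwards [hψ.zero] with ω h0
    funext t
    simp only [Function.comp]
    rw [Finset.sum_coe_sort (Finset.range m)
      (fun i => if i < k t then (ψ (τ (i + 1)) ω : ℝ) - ψ (τ i) ω else 0), ← Finset.sum_filter]
    have : (Finset.range m).filter (· < k t) = Finset.range (k t) := by
      ext i
      have := hkm t
      simp only [Finset.mem_filter, Finset.mem_range]
      omega
    rw [this, Finset.sum_range_sub (fun i => (ψ (τ i) ω : ℝ)), hτ0, h0, hk]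
    simp
  · filter_upwards with ω
    funext t
    simp only [Function.comp]
    rw [Finset.sum_coe_sort (Finset.Ico m n)
      (fun i => if i < l t then (ψ (τ (i + 1)) ω : ℝ) - ψ (τ i) ω else 0), ← Finset.sum_filter]
    have : (Finset.Ico m n).filter (· < l t) = Finset.Ico m (l t) := by
      ext i
      have := hln t
      simp only [Finset.mem_filter, Finset.mem_Ico]
      omega
    rw [this, Finset.sum_Ico_sub (fun i => (ψ (τ i) ω : ℝ)) (hml t), hl, hm, NNReal.sub_def]

/-- Almost surely a subordinator is the sum of its stopped path and its later increments. -/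
lemma IsSubordinator.past_add_future (hψ : IsSubordinator P ψ) (a : ℝ≥0) :
    ∀ᵐ ω ∂P, ∀ t, ψ (min t a) ω + (ψ (max t a) ω - ψ a ω) = ψ t ω := by
  filter_upwards [hψ.paths] with ω hω t
  have hmono := hω.1
  rcases le_total t a with h | h
  · simp [h]
  · rw [min_eq_right h, max_eq_left h]
    exact add_tsub_cancel_of_le (hmono h)

end IndependentIncrements

/-! ### One-dimensional Laplace transforms. -/

section OneDimensional

/-- Nonnegativity makes `f` monotone. Comparing `f (n t)` with the values at the integers around `n
t` bounds `n |f t - t f 1|` by `f 1` for every `n`. -/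
lemma eq_mul_of_additive_of_nonneg (f : ℝ≥0 → ℝ) (hadd : ∀ s t, f (s + t) = f s + f t)
    (h0 : ∀ t, 0 ≤ f t) (t : ℝ≥0) : f t = t * f 1 := by
  have hmono : Monotone f := fun s t hst => by
    rw [← add_tsub_cancel_of_le hst, hadd]
    linarith [h0 (t - s)]
  have hf0 : f 0 = 0 := by have := hadd 0 0; simp at this; exact this
  have hnat : ∀ (n : ℕ) (t : ℝ≥0), f (n * t) = n * f t := by
    intro n t
    induction n with
    | zero => simp [hf0]
    | succ n ih => push_cast; rw [add_mul, hadd, ih]; simp; ring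
  have hbd : ∀ n : ℕ, (n : ℝ) * |f t - t * f 1| ≤ f 1 := by
    intro n
    set k := ⌊(n : ℝ≥0) * t⌋₊
    have h1 : (k : ℝ≥0) ≤ n * t := Nat.floor_le zero_le
    have h2 : (n : ℝ≥0) * t ≤ ((k + 1 : ℕ) : ℝ≥0) := by
      push_cast; exact (Nat.lt_floor_add_one _).le
    have h3 := hmono h1
    have h4 := hmono h2
    have e1 := hnat k 1
    have e2 := hnat (k + 1) 1
    rw [mul_one] at e1 e2
    rw [hnat, e1] at h3
    rw [hnat, e2] at h4
    have h1' : (k : ℝ) ≤ n * t := by exact_mod_cast h1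
    have h2' : (n : ℝ) * t ≤ k + 1 := by exact_mod_cast h2
    push_cast at h4
    have := h0 1
    rw [← Nat.abs_cast n, ← abs_mul, abs_le]
    constructor <;> nlinarith
  by_contra hne
  have hpos : 0 < |f t - t * f 1| := abs_pos.2 (sub_ne_zero.2 hne)
  obtain ⟨n, hn⟩ := exists_nat_gt (f 1 / |f t - t * f 1|)
  rw [div_lt_iff₀ hpos] at hn
  linarith [hbd n]

/-- The Laplace exponent `(1 + u) ^ α - 1` of the tempered stable subordinator. -/
noncomputable def temperedExponent (α u : ℝ) : ℝ := (1 + u) ^ α - 1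

lemma temperedExponent_zero (α : ℝ) : temperedExponent α 0 = 0 := by simp [temperedExponent]

lemma temperedExponent_nonneg {α u : ℝ} (hα : 0 ≤ α) (hu : 0 ≤ u) : 0 ≤ temperedExponent α u :=
  sub_nonneg.2 (Real.one_le_rpow (by linarith) hα)

lemma temperedExponent_mono {α u v : ℝ} (hα : 0 ≤ α) (hu : 0 ≤ u) (huv : u ≤ v) :
    temperedExponent α u ≤ temperedExponent α v :=
  sub_le_sub_right (Real.rpow_le_rpow (by linarith) (by linarith) hα) 1

variable {Ω : Type*} [MeasurableSpace Ω] {P : Measure Ω} {ψ : ℝ≥0 → Ω → ℝ≥0} {α : ℝ}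

lemma integrable_exp_neg [IsFiniteMeasure P] {X : Ω → ℝ} (hX : Measurable X) (h0 : ∀ᵐ ω ∂P, 0 ≤ X ω) :
    Integrable (fun ω => Real.exp (-X ω)) P := by
  refine Integrable.of_bound (by fun_prop) 1 ?_
  filter_upwards [h0] with ω h
  rw [Real.norm_eq_abs, Real.abs_exp, Real.exp_le_one_iff]
  linarith

lemma IsSubordinator.integral_exp_add (hψ : IsSubordinator P ψ) (u : ℝ) (s t : ℝ≥0) :
    ∫ ω, Real.exp (-(u * ψ (s + t) ω)) ∂P =
      (∫ ω, Real.exp (-(u * ψ s ω)) ∂P) * ∫ ω, Real.exp (-(u * ψ t ω)) ∂P := by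
  have hind := hψ.indep.indepFun_eval_sub (zero_le (a := s)) (le_self_add : s ≤ s + t)
    (by filter_upwards [hψ.zero] with ω h; simp [h])
  have hm : Measurable fun x : ℝ => Real.exp (-(u * x)) := by fun_prop
  have hst := ((hψ.stationary s t).comp hm).integral_eq
  simp only [Function.comp_def] at hst
  rw [← hst]
  have := (hind.comp hm hm).integral_fun_mul_eq_mul_integral
    (hm.comp (hψ.measurable s).coe_nnreal_real).aestronglyMeasurable
    (hm.comp ((hψ.measurable (s + t)).coe_nnreal_real.sub
      (hψ.measurable s).coe_nnreal_real)).aestronglyMeasurable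
  simp only [Function.comp_def, Pi.sub_apply] at this
  rw [← this]
  refine integral_congr_ae (ae_of_all _ fun ω => ?_)
  simp only [← Real.exp_add]
  congr 1
  ring

/-- The one-dimensional Laplace transforms of the tempered stable subordinator. -/
theorem IsTemperedStableSubordinator.integral_exp [IsProbabilityMeasure P]
    (hψ : IsTemperedStableSubordinator P α ψ)
    {u : ℝ} (hu : 0 ≤ u) (t : ℝ≥0) :
    ∫ ω, Real.exp (-(u * ψ t ω)) ∂P = Real.exp (-(t * temperedExponent α u)) := by
  have hint : ∀ t, Integrable (fun ω => Real.exp (-(u * ψ t ω))) P := fun t =>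
    integrable_exp_neg ((hψ.measurable t).coe_nnreal_real.const_mul u)
      (ae_of_all _ fun ω => by positivity)
  have hpos : ∀ t, 0 < ∫ ω, Real.exp (-(u * ψ t ω)) ∂P := fun t => integral_exp_pos (hint t)
  -- Independent stationary increments make this additive, hence linear in `t`; its slope is read
  -- off at time `1`.
  let f : ℝ≥0 → ℝ := fun t => -Real.log (∫ ω, Real.exp (-(u * ψ t ω)) ∂P)
  have hf := eq_mul_of_additive_of_nonneg f
    (fun s t => by
      simp only [f, hψ.toIsSubordinator.integral_exp_add, Real.log_mul (hpos s).ne' (hpos t).ne']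
      ring)
    (fun t => by
      refine neg_nonneg.2 (Real.log_nonpos (hpos t).le ?_)
      calc _ ≤ ∫ ω, (1 : ℝ) ∂P := integral_mono (hint t) (integrable_const 1) fun ω => by
            simp only [Real.exp_le_one_iff, neg_nonpos]; positivity
        _ = 1 := by simp) t
  have h1 : f 1 = temperedExponent α u := by
    have := hψ.laplace u hu
    simp only [neg_mul] at this
    simp only [f, this, Real.log_exp, temperedExponent]
    ring
  rw [h1] at hf
  rw [← hf]
  simp only [f, neg_neg, Real.exp_log (hpos t)]

end OneDimensional

/-! ### Finite-dimensional Laplace transforms. -/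

section FiniteDimensional

/-- The total weight `∑_{i ∈ s, x ≤ T i} c i` of the times not before `x`. -/
noncomputable def tailWeight {ι : Type*} (s : Finset ι) (T c : ι → ℝ≥0) (x : ℝ) : ℝ :=
  ∑ i ∈ s, if x ≤ T i then (c i : ℝ) else 0

section TailWeight

variable {ι : Type*} (s : Finset ι) (T c : ι → ℝ≥0)

lemma tailWeight_nonneg (x : ℝ) : 0 ≤ tailWeight s T c x :=
  Finset.sum_nonneg fun i _ => by split_ifs <;> positivity

lemma antitone_tailWeight : Antitone (tailWeight s T c) := by
  intro x y hxy
  refine Finset.sum_le_sum fun i _ => ?_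
  by_cases h : y ≤ T i
  · simp [h, hxy.trans h]
  · rw [if_neg h]
    split_ifs <;> positivity

@[fun_prop]
lemma measurable_tailWeight : Measurable (tailWeight s T c) := (antitone_tailWeight s T c).measurable

lemma tailWeight_eq_zero {x : ℝ} (hx : ∀ i ∈ s, (T i : ℝ) < x) : tailWeight s T c x = 0 :=
  Finset.sum_eq_zero fun i hi => if_neg (not_le.2 (hx i hi))

lemma antitone_temperedExponent_tailWeight {α d : ℝ} (hα : 0 ≤ α) (hd : 0 ≤ d) :
    Antitone fun x => temperedExponent α (d + tailWeight s T c x) := fun _ _ hxy =>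
  temperedExponent_mono hα (add_nonneg hd (tailWeight_nonneg s T c _))
    (add_le_add_right (antitone_tailWeight s T c hxy) d)

end TailWeight

variable {Ω : Type*} [MeasurableSpace Ω] {P : Measure Ω} [IsProbabilityMeasure P]
  {ψ : ℝ≥0 → Ω → ℝ≥0} {α : ℝ}

/-- Induction removing the latest time `a = T m`. The extra term `d ψ(r)` closes the induction: on
`(a, r]` only `d` is active and contributes `(r - a) φ(d)`, while the path up to `a` has the same
form with final weight `c m + d`. -/
lemma IsTemperedStableSubordinator.integral_exp_sum_add (hψ : IsTemperedStableSubordinator P α ψ)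
    (hα : 0 ≤ α) {ι : Type*} (s : Finset ι) (T c : ι → ℝ≥0) :
    ∀ (d r : ℝ≥0), (∀ i ∈ s, T i ≤ r) →
    ∫ ω, Real.exp (-(∑ i ∈ s, (c i : ℝ) * ψ (T i) ω + d * ψ r ω)) ∂P =
      Real.exp (-∫ x in (0 : ℝ)..r, temperedExponent α (d + tailWeight s T c x)) := by
  classical
  induction s using Finset.induction_on_max_value T with
  | empty =>
    intro d r _
    simp [tailWeight, hψ.integral_exp d.coe_nonneg]
  | insert m s hm hmax ih =>
    intro d r hr
    set a := T m with ha
    have har : a ≤ r := hr m (Finset.mem_insert_self m s)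
    have hind := hψ.toIsSubordinator.indepFun_past_future a
    have hfac := (hind.comp
      (φ := fun y : TimePath => Real.exp (-(∑ i ∈ s, (c i : ℝ) * y (T i) + ((c m + d : ℝ≥0) : ℝ) * y a)))
      (ψ := fun y : TimePath => Real.exp (-((d : ℝ) * y r)))
      (by fun_prop) (by fun_prop)).integral_fun_mul_eq_mul_integral
      (Measurable.aestronglyMeasurable (Measurable.comp (by fun_prop)
        (hψ.measurable_past a)))
      (Measurable.aestronglyMeasurable (Measurable.comp (by fun_prop)
        (hψ.measurable_future a)))
    simp only [Function.comp_def] at hfac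
    have hpast := ih (c m + d) a hmax
    have hpast' : ∫ ω, Real.exp (-(∑ i ∈ s, (c i : ℝ) * ψ (min (T i) a) ω +
        ((c m + d : ℝ≥0) : ℝ) * ψ (min a a) ω)) ∂P =
        Real.exp (-∫ x in (0 : ℝ)..a, temperedExponent α ((c m + d : ℝ≥0) + tailWeight s T c x)) := by
      rw [← hpast, min_self]
      refine integral_congr_ae (ae_of_all _ fun ω => ?_)
      simp only
      congr 3
      exact Finset.sum_congr rfl fun i hi => by rw [min_eq_left (hmax i hi)]
    have hfut : ∫ ω, Real.exp (-((d : ℝ) * ((ψ (max r a) ω - ψ a ω : ℝ≥0) : ℝ))) ∂P =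
        Real.exp (-((r - a) * temperedExponent α d)) := by
      have hst := ((hψ.stationary a (r - a)).comp
        (u := fun x : ℝ => Real.exp (-(d * x))) (by fun_prop)).integral_eq
      simp only [Function.comp_def] at hst
      rw [hψ.integral_exp d.coe_nonneg, add_tsub_cancel_of_le har, NNReal.coe_sub har] at hst
      rw [← hst]
      refine integral_congr_ae ?_
      filter_upwards [hψ.paths] with ω hω
      rw [max_eq_left har, NNReal.coe_sub (hω.1 har)]
    rw [hpast', hfut] at hfac
    have hlhs : ∫ ω, Real.exp (-(∑ i ∈ insert m s, (c i : ℝ) * ψ (T i) ω + d * ψ r ω)) ∂P =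
        ∫ ω, Real.exp (-(∑ i ∈ s, (c i : ℝ) * ψ (min (T i) a) ω +
        ((c m + d : ℝ≥0) : ℝ) * ψ (min a a) ω)) *
          Real.exp (-((d : ℝ) * ((ψ (max r a) ω - ψ a ω : ℝ≥0) : ℝ))) ∂P := by
      refine integral_congr_ae ?_
      filter_upwards [hψ.paths] with ω hω
      have hsum : ∑ i ∈ s, (c i : ℝ) * ψ (min (T i) a) ω = ∑ i ∈ s, (c i : ℝ) * ψ (T i) ω :=
        Finset.sum_congr rfl fun i hi => by rw [min_eq_left (hmax i hi)]
      rw [max_eq_left har, NNReal.coe_sub (hω.1 har), ← Real.exp_add, Finset.sum_insert hm,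
        min_self, hsum]
      congr 1
      push_cast
      rw [← ha]
      ring
    rw [hlhs, hfac, ← Real.exp_add]
    congr 1
    have hanti := antitone_temperedExponent_tailWeight (insert m s) T c hα d.coe_nonneg
    have hsplit := intervalIntegral.integral_add_adjacent_intervals
      (hanti.intervalIntegrable (μ := volume) (a := 0) (b := (a : ℝ)))
      (hanti.intervalIntegrable (μ := volume) (a := (a : ℝ)) (b := (r : ℝ)))
    rw [← hsplit, neg_add]
    congr 1
    · congr 1
      refine intervalIntegral.integral_congr_ae (ae_of_all _ fun x hx => ?_)
      rw [uIoc_of_le (NNReal.coe_nonneg a)] at hx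
      congr 1
      simp only [tailWeight]
      rw [Finset.sum_insert hm, if_pos (by rw [← ha]; exact hx.2)]
      push_cast
      ring
    · congr 1
      have : ∫ x in (a : ℝ)..r, temperedExponent α (d + tailWeight (insert m s) T c x) =
          ∫ x in (a : ℝ)..r, temperedExponent α d := by
        refine intervalIntegral.integral_congr_ae (ae_of_all _ fun x hx => ?_)
        rw [uIoc_of_le (NNReal.coe_le_coe.2 har)] at hx
        rw [tailWeight_eq_zero, add_zero]
        intro i hi
        refine lt_of_le_of_lt (NNReal.coe_le_coe.2 ?_) hx.1
        rcases Finset.mem_insert.1 hi with rfl | hi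
        · exact le_rfl
        · exact hmax i hi
      rw [this]
      simp

/-- The Laplace transforms of the finite-dimensional marginals. -/
theorem IsTemperedStableSubordinator.integral_exp_sum (hψ : IsTemperedStableSubordinator P α ψ)
    (hα : 0 ≤ α) {ι : Type*} (s : Finset ι) (T c : ι → ℝ≥0) (r : ℝ≥0) (hr : ∀ i ∈ s, T i ≤ r) :
    ∫ ω, Real.exp (-∑ i ∈ s, (c i : ℝ) * ψ (T i) ω) ∂P =
      Real.exp (-∫ x in (0 : ℝ)..r, temperedExponent α (tailWeight s T c x)) := by
  simpa using hψ.integral_exp_sum_add hα s T c 0 r hr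

/-- Slowing the clock by the factor `n` takes the `n`-th root of the Laplace transforms. -/
theorem IsTemperedStableSubordinator.integral_exp_sum_div_pow
    (hψ : IsTemperedStableSubordinator P α ψ)
    (hα : 0 ≤ α) {ι : Type*} (s : Finset ι) (T c : ι → ℝ≥0) {n : ℕ} (hn : n ≠ 0) :
    (∫ ω, Real.exp (-∑ i ∈ s, (c i : ℝ) * ψ (T i / n) ω) ∂P) ^ n =
      ∫ ω, Real.exp (-∑ i ∈ s, (c i : ℝ) * ψ (T i) ω) ∂P := by
  have hr : ∀ i ∈ s, T i ≤ s.sup T := fun i hi => Finset.le_sup hi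
  have hn' : (0 : ℝ) < n := by positivity
  rw [hψ.integral_exp_sum hα s T c _ hr,
    hψ.integral_exp_sum hα s (fun i => T i / n) c (s.sup T / n) fun i hi =>
      div_le_div_of_nonneg_right (hr i hi) zero_le, ← Real.exp_nat_mul]
  congr 1
  rw [mul_neg]
  congr 1
  -- Dividing the times by `n` dilates the tail weight, and the substitution `x ↦ n x` divides the
  -- exponent by `n`.
  have : ∀ x : ℝ, tailWeight s (fun i => T i / n) c x = tailWeight s T c (n * x) := by
    intro x
    refine Finset.sum_congr rfl fun i _ => ?_
    have : x ≤ ((T i / n : ℝ≥0) : ℝ) ↔ n * x ≤ T i := by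
      push_cast
      rw [le_div_iff₀ hn', mul_comm]
    simp only [this]
  simp only [this]
  rw [intervalIntegral.integral_comp_mul_left
    (fun x => temperedExponent α (tailWeight s T c x)) hn'.ne']
  push_cast
  rw [mul_zero, mul_div_cancel₀ _ hn'.ne', smul_eq_mul, ← mul_assoc, mul_inv_cancel₀ hn'.ne', one_mul]

end FiniteDimensional

/-! ### The tempered jump measure and its exponent. -/

section JumpMeasure

lemma lintegral_rpow_mul_exp_neg_mul_Ioi {b r : ℝ} (hb : 0 < b) (hr : 0 < r) :
    ∫⁻ x in Ioi (0 : ℝ), ENNReal.ofReal (x ^ (b - 1) * Real.exp (-(r * x))) =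
      ENNReal.ofReal ((1 / r) ^ b * Real.Gamma b) := by
  have h := Real.integral_rpow_mul_exp_neg_mul_Ioi hb hr
  rw [← h, ofReal_integral_eq_lintegral_ofReal]
  -- A non-integrable function would have integral `0`, but the value here is positive.
  · refine not_imp_comm.1 integral_undef ?_
    rw [h]
    have := Real.Gamma_pos_of_pos hb
    positivity
  · refine (ae_restrict_iff' measurableSet_Ioi).2 (ae_of_all _ fun x (hx : 0 < x) => ?_)
    positivity

lemma abs_Gamma_neg {α : ℝ} (hα : α ∈ Ioo (0 : ℝ) 1) :
    |Real.Gamma (-α)| = Real.Gamma (1 - α) / α := by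
  have h := Real.Gamma_add_one (s := -α) (by linarith [hα.1])
  have hG : 0 < Real.Gamma (1 - α) := Real.Gamma_pos_of_pos (by linarith [hα.2])
  rw [show -α + 1 = 1 - α by ring] at h
  have h0 : α ≠ 0 := hα.1.ne'
  have : Real.Gamma (-α) = -(Real.Gamma (1 - α) / α) := by rw [h]; field_simp
  rw [this, abs_neg, abs_of_pos (div_pos hG hα.1)]

/-- The jump measure `|Γ(-α)|⁻¹ x ^ (-α - 1) e ^ (-x) dx` on `(0, ∞)`. -/
noncomputable def temperedJumpMeasure (α : ℝ) : Measure ℝ :=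
  ENNReal.ofReal (1 / |Real.Gamma (-α)|) • (volume.restrict (Ioi (0 : ℝ))).withDensity
    fun x => ENNReal.ofReal (x ^ (-α - 1) * Real.exp (-x))

instance (α : ℝ) : SFinite (temperedJumpMeasure α) := by
  unfold temperedJumpMeasure
  infer_instance

lemma measurable_temperedDensity (α : ℝ) :
    Measurable fun x : ℝ => ENNReal.ofReal (x ^ (-α - 1) * Real.exp (-x)) := by fun_prop

lemma lintegral_temperedJumpMeasure (α : ℝ) {f : ℝ → ℝ≥0∞} (hf : Measurable f) :
    ∫⁻ x, f x ∂(temperedJumpMeasure α) = ENNReal.ofReal (1 / |Real.Gamma (-α)|) *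
      ∫⁻ x in Ioi (0 : ℝ), f x * ENNReal.ofReal (x ^ (-α - 1) * Real.exp (-x)) := by
  rw [temperedJumpMeasure, lintegral_smul_measure,
    lintegral_withDensity_eq_lintegral_mul _ (measurable_temperedDensity α) hf, smul_eq_mul]
  simp only [Pi.mul_apply, mul_comm]

lemma integral_mul_exp_neg_mul (x u : ℝ) :
    ∫ v in (0 : ℝ)..u, x * Real.exp (-(v * x)) = 1 - Real.exp (-(u * x)) := by
  have : ∀ v ∈ uIcc 0 u, HasDerivAt (fun v => -Real.exp (-(v * x))) (x * Real.exp (-(v * x))) v := by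
    intro v _
    have h := (((hasDerivAt_id v).mul_const x).neg.exp).neg
    convert! h using 1
    simp only [Pi.neg_apply, id]
    ring
  rw [intervalIntegral.integral_eq_sub_of_hasDerivAt this
    (Continuous.intervalIntegrable (by fun_prop) _ _)]
  simp only [zero_mul, neg_zero, Real.exp_zero]
  ring

lemma integral_one_add_rpow {α u : ℝ} (hα : 0 < α) (hu : 0 ≤ u) :
    ∫ v in (0 : ℝ)..u, (1 + v) ^ (α - 1) = temperedExponent α u / α := by
  have : ∀ v ∈ uIcc 0 u, HasDerivAt (fun v => (1 + v) ^ α / α) ((1 + v) ^ (α - 1)) v := by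
    intro v hv
    rw [uIcc_of_le hu] at hv
    have h := ((((hasDerivAt_id v).const_add 1).rpow_const (p := α)
      (Or.inl (by simp only [id]; linarith [hv.1]))).div_const α)
    convert! h using 1
    simp only [id]
    field_simp
  rw [intervalIntegral.integral_eq_sub_of_hasDerivAt this]
  · simp only [temperedExponent, add_zero, Real.one_rpow]
    ring
  · refine ContinuousOn.intervalIntegrable fun v hv => ContinuousAt.continuousWithinAt ?_
    rw [uIcc_of_le hu] at hv
    exact ContinuousAt.rpow_const (by fun_prop) (Or.inl (by linarith [hv.1]))

/-- `∫ (1 - e ^ (-ux))` against the jump measure is `(1 + u) ^ α - 1`. -/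
theorem lintegral_one_sub_exp_temperedJumpMeasure {α : ℝ} (hα : α ∈ Ioo (0 : ℝ) 1) {u : ℝ}
    (hu : 0 ≤ u) :
    ∫⁻ x, ENNReal.ofReal (1 - Real.exp (-(u * x))) ∂(temperedJumpMeasure α) =
      ENNReal.ofReal (temperedExponent α u) := by
  have hΓ : 0 < Real.Gamma (1 - α) := Real.Gamma_pos_of_pos (by linarith [hα.2])
  have h0 : α ≠ 0 := hα.1.ne'
  rw [lintegral_temperedJumpMeasure α (by fun_prop)]
  -- Write `1 - e ^ (-ux)` as the integral of `x e ^ (-vx)` over `v ∈ (0, u]` and swap. The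
  -- `x`-integral is `Γ(1 - α) (1 + v) ^ (α - 1)`, and integrating in `v` gives `φ(u) Γ(1 - α) / α =
  -- φ(u) |Γ(-α)|`.
  have h1 : ∫⁻ x in Ioi (0 : ℝ), ENNReal.ofReal (1 - Real.exp (-(u * x))) *
      ENNReal.ofReal (x ^ (-α - 1) * Real.exp (-x)) =
      ∫⁻ x in Ioi (0 : ℝ), ∫⁻ v in Ioc (0 : ℝ) u,
        ENNReal.ofReal (x ^ ((1 - α) - 1) * Real.exp (-((1 + v) * x))) := by
    refine setLIntegral_congr_fun measurableSet_Ioi fun x (hx : 0 < x) => ?_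
    rw [← integral_mul_exp_neg_mul, intervalIntegral.integral_of_le hu,
      ofReal_integral_eq_lintegral_ofReal, ← lintegral_mul_const _ (by fun_prop)]
    · refine lintegral_congr fun v => ?_
      rw [← ENNReal.ofReal_mul (by positivity)]
      congr 1
      have e1 : x ^ ((1 - α) - 1) = x * x ^ (-α - 1) := by
        rw [← Real.rpow_one_add' hx.le (by linarith [hα.1])]
        congr 1; ring
      have e2 : Real.exp (-((1 + v) * x)) = Real.exp (-(v * x)) * Real.exp (-x) := by
        rw [← Real.exp_add]; congr 1; ring
      rw [e1, e2]; ring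
    · exact (Continuous.intervalIntegrable (by fun_prop) 0 u).1
    · exact ae_of_all _ fun v => by positivity
  have h2 : ∀ v ∈ Ioc (0 : ℝ) u, ∫⁻ x in Ioi (0 : ℝ),
      ENNReal.ofReal (x ^ ((1 - α) - 1) * Real.exp (-((1 + v) * x))) =
      ENNReal.ofReal (Real.Gamma (1 - α)) * ENNReal.ofReal ((1 + v) ^ (α - 1)) := by
    intro v hv
    have hv' : 0 < 1 + v := by linarith [hv.1]
    rw [lintegral_rpow_mul_exp_neg_mul_Ioi (by linarith [hα.2]) hv', ← ENNReal.ofReal_mul hΓ.le,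
      mul_comm, one_div, Real.inv_rpow hv'.le, ← Real.rpow_neg hv'.le, neg_sub]
  rw [h1, lintegral_lintegral_swap (Measurable.aemeasurable (by fun_prop)),
    setLIntegral_congr_fun measurableSet_Ioc h2,
    lintegral_const_mul _ (by fun_prop), ← ofReal_integral_eq_lintegral_ofReal,
    ← intervalIntegral.integral_of_le hu, integral_one_add_rpow hα.1 hu, abs_Gamma_neg hα,
    ← ENNReal.ofReal_mul hΓ.le, ← ENNReal.ofReal_mul (by have := hα.1; positivity)]
  · congr 1
    field_simp
  · refine (ContinuousOn.intervalIntegrable (u := fun v : ℝ => (1 + v) ^ (α - 1))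
      (a := 0) (b := u) (μ := volume) fun v hv => ContinuousAt.continuousWithinAt ?_).1
    rw [uIcc_of_le hu] at hv
    exact ContinuousAt.rpow_const (by fun_prop) (Or.inl (by linarith [hv.1]))
  · refine (ae_restrict_iff' measurableSet_Ioc).2 (ae_of_all _ fun v hv => ?_)
    have : 0 < 1 + v := by linarith [hv.1]
    exact Real.rpow_nonneg this.le _

end JumpMeasure

/-! ### Lévy measures carried by step paths. -/

section StepPaths

lemma stepPath_apply (x s t : ℝ≥0) : stepPath x s t = if s ≤ t then x else 0 := by
  simp [stepPath, indicator_apply]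

@[fun_prop]
lemma measurable_stepPath : Measurable fun p : ℝ≥0 × ℝ≥0 => stepPath p.1 p.2 := by
  refine measurable_pi_lambda _ fun t => ?_
  simp only [stepPath_apply]
  exact Measurable.ite (measurableSet_le measurable_snd measurable_const) measurable_fst
    measurable_const

lemma pathExp_stepPath (I : Finset ℝ≥0) (c : ℝ≥0 → ℝ≥0) (x s : ℝ≥0) :
    pathExp I c (stepPath x s) = Real.exp (-(tailWeight I id c s * x)) := by
  rw [pathExp, tailWeight, Finset.sum_mul]
  congr 2
  refine Finset.sum_congr rfl fun t _ => ?_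
  rw [stepPath_apply]
  by_cases h : s ≤ t <;> simp [h]

lemma measurable_stepPath_toNNReal :
    Measurable fun p : ℝ × ℝ => stepPath p.2.toNNReal p.1.toNNReal :=
  measurable_stepPath.comp (measurable_snd.real_toNNReal.prodMk measurable_fst.real_toNNReal)

/-- The image of `ds ⊗ |Γ(-α)|⁻¹ x ^ (-α - 1) e ^ (-x) dx` on `S × (0, ∞)` under
`(s, x) ↦ x 1_{[s, ∞)}`. -/
noncomputable def temperedLevyMeasure (α : ℝ) (S : Set ℝ) : Measure TimePath :=
  ((volume.restrict S).prod (temperedJumpMeasure α)).map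
    fun p => stepPath p.2.toNNReal p.1.toNNReal

lemma lintegral_temperedLevyMeasure_eq (α : ℝ) (S : Set ℝ) {F : TimePath → ℝ≥0∞}
    (hF : Measurable F) : ∫⁻ y, F y ∂(temperedLevyMeasure α S) =
      ∫⁻ s in S, ∫⁻ x, F (stepPath x.toNNReal s.toNNReal) ∂(temperedJumpMeasure α) := by
  rw [temperedLevyMeasure, lintegral_map hF measurable_stepPath_toNNReal,
    lintegral_prod (fun p : ℝ × ℝ => F (stepPath p.2.toNNReal p.1.toNNReal))
      (hF.comp measurable_stepPath_toNNReal).aemeasurable]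

theorem lintegral_temperedLevyMeasure (α : ℝ) (S : Set ℝ) {F : TimePath → ℝ≥0∞}
    (hF : Measurable F) :
    ∫⁻ y, F y ∂(temperedLevyMeasure α S) = temperedJumpIntegral α S F := by
  have hm : Measurable fun p : ℝ × ℝ => F (stepPath p.2.toNNReal p.1.toNNReal) :=
    hF.comp measurable_stepPath_toNNReal
  rw [lintegral_temperedLevyMeasure_eq α S hF, temperedJumpIntegral, ← lintegral_const_mul]
  · refine lintegral_congr fun s => ?_
    exact lintegral_temperedJumpMeasure α (hm.comp (measurable_const.prodMk measurable_id))
  · exact Measurable.lintegral_prod_right'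
      (f := fun p : ℝ × ℝ => F (stepPath p.2.toNNReal p.1.toNNReal) *
        ENNReal.ofReal (p.2 ^ (-α - 1) * Real.exp (-p.2)))
      (hm.mul ((measurable_temperedDensity α).comp measurable_snd))

/-- Along `x 1_{[s, ∞)}` the exponential is `e ^ (-C(s) x)`, so the `x`-integral is `φ(C(s))`. The
condition `S ⊆ Ioi 0` makes truncation to nonnegative times harmless. -/
lemma lintegral_one_sub_pathExp_temperedLevyMeasure {α : ℝ} (hα : α ∈ Ioo (0 : ℝ) 1) {S : Set ℝ}
    (hS : MeasurableSet S) (hS0 : S ⊆ Ioi 0) (I : Finset ℝ≥0) (c : ℝ≥0 → ℝ≥0) :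
    ∫⁻ y, ENNReal.ofReal (1 - pathExp I c y) ∂(temperedLevyMeasure α S) =
      ∫⁻ s in S, ENNReal.ofReal (temperedExponent α (tailWeight I id c s)) := by
  rw [lintegral_temperedLevyMeasure_eq α S (by fun_prop)]
  refine setLIntegral_congr_fun hS fun s hs => ?_
  have hs0 : 0 < s := hS0 hs
  rw [← lintegral_one_sub_exp_temperedJumpMeasure hα (tailWeight_nonneg I id c s),
    lintegral_temperedJumpMeasure α, lintegral_temperedJumpMeasure α (by fun_prop)]
  · congr 1
    refine setLIntegral_congr_fun measurableSet_Ioi fun x (hx : 0 < x) => ?_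
    simp only [pathExp_stepPath]
    rw [Real.coe_toNNReal s hs0.le, Real.coe_toNNReal x hx.le]
  · simp only [pathExp_stepPath]
    fun_prop

/-- From `e ^ (-z) ≤ 1 / (1 + z)` one gets `1 - e ^ (-z) ≥ z / (1 + z)`, at least half of `z ∧ 1`.
-/
lemma min_one_le_two_mul (z : ℝ) (hz : 0 ≤ z) : min z 1 ≤ 2 * (1 - Real.exp (-z)) := by
  have h1 : Real.exp (-z) ≤ 1 / (1 + z) := by
    rw [Real.exp_neg, one_div]
    exact inv_anti₀ (by linarith) (by linarith [Real.add_one_le_exp z])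
  have h2 : 1 / (1 + z) = 1 - z / (1 + z) := by field_simp; ring
  rcases le_total z 1 with h | h
  · rw [min_eq_left h]
    have : z / 2 ≤ z / (1 + z) := div_le_div_of_nonneg_left hz (by linarith) (by linarith)
    linarith
  · rw [min_eq_right h]
    have : 1 / 2 ≤ z / (1 + z) := by rw [div_le_div_iff₀ (by norm_num) (by linarith)]; linarith
    linarith

lemma temperedLevyMeasure_lintegral_lt_top {α : ℝ} (hα : α ∈ Ioo (0 : ℝ) 1) {S : Set ℝ}
    (hS : MeasurableSet S) (hS0 : S ⊆ Ioi 0) (t : ℝ≥0) :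
    ∫⁻ y, (min (y t) 1 : ℝ≥0) ∂(temperedLevyMeasure α S) < ∞ := by
  calc ∫⁻ y, (min (y t) 1 : ℝ≥0) ∂(temperedLevyMeasure α S)
      ≤ ∫⁻ y, 2 * ENNReal.ofReal (1 - pathExp {t} 1 y) ∂(temperedLevyMeasure α S) := by
        refine lintegral_mono fun y => ?_
        rw [← ENNReal.ofReal_coe_nnreal, ← ENNReal.ofReal_ofNat 2, ← ENNReal.ofReal_mul zero_le_two]
        refine ENNReal.ofReal_le_ofReal ?_
        simpa [pathExp] using min_one_le_two_mul (y t) (y t).coe_nonneg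
    _ = 2 * ∫⁻ s in S, ENNReal.ofReal (temperedExponent α (tailWeight {t} id 1 s)) := by
        rw [lintegral_const_mul _ (by fun_prop),
          lintegral_one_sub_pathExp_temperedLevyMeasure hα hS hS0]
    _ ≤ 2 * ∫⁻ s in Ioi (0 : ℝ), (Ioc (0 : ℝ) t).indicator
          (fun _ => ENNReal.ofReal (temperedExponent α 1)) s := by
        gcongr 2 * ?_
        refine (lintegral_mono_set hS0).trans (setLIntegral_mono_ae'
          measurableSet_Ioi (ae_of_all _ fun s (hs : 0 < s) => ?_))
        by_cases h : s ≤ t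
        · rw [indicator_of_mem (show s ∈ Ioc (0 : ℝ) t from ⟨hs, h⟩), tailWeight, Finset.sum_singleton, id, if_pos h]
          simp
        · rw [tailWeight, Finset.sum_singleton, id, if_neg h, temperedExponent_zero]
          simp
    _ < ∞ := by
        refine ENNReal.mul_lt_top (by simp) ?_
        refine (setLIntegral_le_lintegral _ _).trans_lt ?_
        rw [lintegral_indicator_const measurableSet_Ioc, Real.volume_Ioc]
        exact ENNReal.mul_lt_top ENNReal.ofReal_lt_top ENNReal.ofReal_lt_top

/-- The singleton `{0}` is not measurable. A step path with positive jump is nonzero at some integer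
time, so the measurable set `D` of such paths has null complement, and `A ∩ D` attains the supremum.
-/
lemma temperedLevyMeasure_inner (α : ℝ) (S : Set ℝ) {A : Set TimePath} (hA : MeasurableSet A) :
    temperedLevyMeasure α S A = ⨆ (B : Set TimePath) (_ : MeasurableSet B) (_ : B ⊆ A \ {0}),
      temperedLevyMeasure α S B := by
  set D : Set TimePath := ⋃ n : ℕ, {y | y n ≠ 0} with hD
  have hDm : MeasurableSet D := MeasurableSet.iUnion fun n => measurableSet_coordinate_ne_zero n
  have hnull : temperedLevyMeasure α S Dᶜ = 0 := by
    rw [← lintegral_indicator_one hDm.compl,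
      lintegral_temperedLevyMeasure α S (measurable_one.indicator hDm.compl), temperedJumpIntegral]
    refine mul_eq_zero.2 (Or.inr ?_)
    refine (lintegral_congr fun s => ?_).trans lintegral_zero
    refine (setLIntegral_congr_fun measurableSet_Ioi fun x (hx : 0 < x) => ?_).trans lintegral_zero
    have : stepPath x.toNNReal s.toNNReal ∈ D := by
      refine mem_iUnion.2 ⟨⌈s.toNNReal⌉₊, ?_⟩
      change stepPath _ _ _ ≠ 0
      rw [stepPath_apply, if_pos (Nat.le_ceil _)]
      exact (Real.toNNReal_pos.2 hx).ne'
    simp [this]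
  refine le_antisymm ?_ (iSup_le fun B => iSup_le fun _ => iSup_le fun hBA =>
    measure_mono (hBA.trans sdiff_subset))
  calc temperedLevyMeasure α S A ≤ temperedLevyMeasure α S (A ∩ D) := by
        rw [measure_inter_conull hnull]
    _ ≤ _ := by
        refine le_iSup_of_le (A ∩ D) (le_iSup_of_le (hA.inter hDm) (le_iSup_of_le ?_ le_rfl))
        rintro y ⟨hyA, hyD⟩
        refine ⟨hyA, ?_⟩
        rintro rfl
        simp [hD] at hyD

/-- A law whose Laplace functional is driven by jumps at times in `S` has Lévy measure
`temperedLevyMeasure α S`. -/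
theorem isLevyMeasure_temperedLevyMeasure {α : ℝ} (hα : α ∈ Ioo (0 : ℝ) 1) {S : Set ℝ}
    (hS : MeasurableSet S) (hS0 : S ⊆ Ioi 0) {μ : Measure TimePath}
    (hμ : ∀ I c, ∫ y, pathExp I c y ∂μ =
      Real.exp (-∫ s in S, temperedExponent α (tailWeight I id c s))) :
    IsLevyMeasure μ (temperedLevyMeasure α S) where
  laplace I c := by
    refine (hμ I c).trans ?_
    congr 2
    change _ = ∫ y, (1 - pathExp I c y) ∂(temperedLevyMeasure α S)
    rw [integral_eq_lintegral_of_nonneg_ae, integral_eq_lintegral_of_nonneg_ae,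
      lintegral_one_sub_pathExp_temperedLevyMeasure hα hS hS0]
    · exact ae_of_all _ fun y => sub_nonneg.2 (pathExp_le_one I c y)
    · fun_prop
    · exact ae_of_all _ fun s => temperedExponent_nonneg hα.1.le (tailWeight_nonneg I id c s)
    · refine Measurable.aestronglyMeasurable ?_
      unfold temperedExponent
      fun_prop
  lintegral_lt_top t := temperedLevyMeasure_lintegral_lt_top hα hS hS0 t
  inner A hA := temperedLevyMeasure_inner α S hA

theorem IsLevyMeasure.existsUnique {μ ν : Measure TimePath} (h : IsLevyMeasure μ ν) :
    ∃! ν, IsLevyMeasure μ ν :=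
  ⟨ν, h, fun _ h' => h'.unique h⟩

end StepPaths

/-! ### Laplace functionals of `ψ`, its stopped path and its later increments. -/

section PathLaplace

variable {Ω : Type*} [MeasurableSpace Ω] {P : Measure Ω} {ψ : ℝ≥0 → Ω → ℝ≥0} {α : ℝ}

lemma integral_pathLaw {X : ℝ≥0 → Ω → ℝ≥0} (hX : Measurable fun ω t => X t ω)
    {f : TimePath → ℝ} (hf : Measurable f) :
    ∫ y, f y ∂(pathLaw P X) = ∫ ω, f (fun t => X t ω) ∂P :=
  integral_map hX.aemeasurable hf.aestronglyMeasurable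

lemma integrableOn_temperedExponent_tailWeight (hα : 0 ≤ α) (I : Finset ℝ≥0) (c : ℝ≥0 → ℝ≥0) :
    IntegrableOn (fun s => temperedExponent α (tailWeight I id c s)) (Ioi 0) := by
  have h := antitone_temperedExponent_tailWeight I id c hα le_rfl
  simp only [zero_add] at h
  refine IntegrableOn.of_forall_sdiff_eq_zero
    ((intervalIntegrable_iff_integrableOn_Ioc_of_le (I.sup id).coe_nonneg).1
      (h.intervalIntegrable (a := 0) (b := (I.sup id : ℝ≥0)))) measurableSet_Ioi ?_
  rintro x ⟨hx0 : 0 < x, hx⟩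
  rw [tailWeight_eq_zero, temperedExponent_zero]
  intro t ht
  have : (t : ℝ) ≤ (I.sup id : ℝ≥0) := NNReal.coe_le_coe.2 (Finset.le_sup (f := id) ht)
  refine lt_of_le_of_lt this ?_
  by_contra hle
  exact hx ⟨hx0, not_lt.1 hle⟩

variable [IsProbabilityMeasure P]

lemma IsTemperedStableSubordinator.integral_pathExp_pathLaw
    (hψ : IsTemperedStableSubordinator P α ψ) (hα : 0 ≤ α) (I : Finset ℝ≥0) (c : ℝ≥0 → ℝ≥0) :
    ∫ y, pathExp I c y ∂(pathLaw P ψ) =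
      Real.exp (-∫ s in Ioi (0 : ℝ), temperedExponent α (tailWeight I id c s)) := by
  rw [integral_pathLaw (measurable_pi_lambda _ hψ.measurable) (measurable_pathExp I c)]
  refine (hψ.integral_exp_sum hα I id c (I.sup id) fun t ht => Finset.le_sup (f := id) ht).trans ?_
  rw [intervalIntegral.integral_of_le (I.sup id).coe_nonneg,
    setIntegral_eq_of_subset_of_forall_sdiff_eq_zero measurableSet_Ioi Ioc_subset_Ioi_self]
  rintro x ⟨hx0 : 0 < x, hx⟩
  rw [tailWeight_eq_zero, temperedExponent_zero]
  intro t ht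
  have : (t : ℝ) ≤ (I.sup id : ℝ≥0) := NNReal.coe_le_coe.2 (Finset.le_sup (f := id) ht)
  refine lt_of_le_of_lt this ?_
  by_contra hle
  exact hx ⟨hx0, not_lt.1 hle⟩

lemma IsTemperedStableSubordinator.integral_pathExp_past
    (hψ : IsTemperedStableSubordinator P α ψ) (hα : 0 ≤ α) (a : ℝ≥0) (I : Finset ℝ≥0)
    (c : ℝ≥0 → ℝ≥0) :
    ∫ y, pathExp I c y ∂(pathLaw P fun t ω => ψ (min t a) ω) =
      Real.exp (-∫ s in Ioc 0 (a : ℝ), temperedExponent α (tailWeight I id c s)) := by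
  rw [integral_pathLaw (hψ.measurable_past a) (measurable_pathExp I c)]
  refine (hψ.integral_exp_sum hα I (min · a) c a fun t _ => min_le_right _ _).trans ?_
  rw [intervalIntegral.integral_of_le a.coe_nonneg]
  congr 2
  refine setIntegral_congr_fun measurableSet_Ioc fun x hx => ?_
  simp only [tailWeight, NNReal.coe_min, le_min_iff, hx.2, and_true, id]

/-- The Laplace functional of a subordinator factors at each time `a`. -/
lemma IsSubordinator.integral_pathExp_mul (hψ : IsSubordinator P ψ) (a : ℝ≥0) (I : Finset ℝ≥0)
    (c : ℝ≥0 → ℝ≥0) :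
    ∫ y, pathExp I c y ∂(pathLaw P ψ) =
      (∫ y, pathExp I c y ∂(pathLaw P fun t ω => ψ (min t a) ω)) *
        ∫ y, pathExp I c y ∂(pathLaw P fun t ω => ψ (max t a) ω - ψ a ω) := by
  have hm := measurable_pathExp I c
  rw [integral_pathLaw (measurable_pi_lambda _ hψ.measurable) hm,
    integral_pathLaw (hψ.measurable_past a) hm, integral_pathLaw (hψ.measurable_future a) hm]
  have := ((hψ.indepFun_past_future a).comp hm hm).integral_fun_mul_eq_mul_integral
    (hm.comp (hψ.measurable_past a)).aestronglyMeasurable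
    (hm.comp (hψ.measurable_future a)).aestronglyMeasurable
  simp only [Function.comp_def] at this
  rw [← this]
  refine integral_congr_ae ?_
  filter_upwards [hψ.past_add_future a] with ω hω
  rw [← pathExp_add]
  congr 1
  funext t
  exact (hω t).symm

/-- The functional of the later increments is the quotient of the full one by the stopped one, so
the exponents subtract. -/
lemma IsTemperedStableSubordinator.integral_pathExp_future
    (hψ : IsTemperedStableSubordinator P α ψ) (hα : 0 ≤ α) (a : ℝ≥0) (I : Finset ℝ≥0)
    (c : ℝ≥0 → ℝ≥0) :
    ∫ y, pathExp I c y ∂(pathLaw P fun t ω => ψ (max t a) ω - ψ a ω) =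
      Real.exp (-∫ s in Ioi (a : ℝ), temperedExponent α (tailWeight I id c s)) := by
  have h := hψ.toIsSubordinator.integral_pathExp_mul a I c
  have hint := integrableOn_temperedExponent_tailWeight hα I c
  rw [hψ.integral_pathExp_pathLaw hα, hψ.integral_pathExp_past hα,
    ← Ioc_union_Ioi_eq_Ioi a.coe_nonneg, setIntegral_union Ioc_disjoint_Ioi_same measurableSet_Ioi
      (hint.mono_set Ioc_subset_Ioi_self) (hint.mono_set (Ioi_subset_Ioi a.coe_nonneg)),
    neg_add, Real.exp_add] at h
  exact (mul_left_cancel₀ (Real.exp_pos _).ne' h).symm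

end PathLaplace

/-! ### Infinite divisibility by slowing the clock. -/

section InfinitelyDivisible

/-- The sum of `n` independent copies of a marginal of `ρ` has the `n`-th power as Laplace
transform, and transforms determine the marginals of `μ`. -/
lemma isInfDivLaw_of_laplace_root {μ : Measure TimePath} [IsProbabilityMeasure μ]
    (h : ∀ n : ℕ, n ≠ 0 → ∃ ρ : Measure TimePath, IsProbabilityMeasure ρ ∧
      ∀ I c, (∫ y, pathExp I c y ∂ρ) ^ n = ∫ y, pathExp I c y ∂μ) : IsInfDivLaw μ := by
  refine ⟨inferInstance, fun I n hn => ?_⟩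
  obtain ⟨ρ, hρ, hlap⟩ := h n (by omega)
  let coe : (I → ℝ≥0) → (I → ℝ) := fun y t => (y t : ℝ)
  have hcoe : Measurable coe := by fun_prop
  have hres : Measurable (I.restrict : TimePath → I → ℝ≥0) := by fun_prop
  have hρI : IsProbabilityMeasure (ρ.map I.restrict) :=
    Measure.isProbabilityMeasure_map hres.aemeasurable
  refine ⟨(ρ.map I.restrict).map coe, Measure.isProbabilityMeasure_map hcoe.aemeasurable, ?_⟩
  have hsum : Measurable fun x : Fin n → I → ℝ≥0 => ∑ k, x k := by fun_prop
  have hkey : μ.map I.restrict =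
      (Measure.pi fun _ : Fin n => ρ.map I.restrict).map fun x => ∑ k, x k := by
    have : IsProbabilityMeasure (μ.map I.restrict) :=
      Measure.isProbabilityMeasure_map hres.aemeasurable
    have : IsProbabilityMeasure
        ((Measure.pi fun _ : Fin n => ρ.map I.restrict).map fun x => ∑ k, x k) :=
      Measure.isProbabilityMeasure_map hsum.aemeasurable
    refine ext_of_laplace_pi fun c => ?_
    rw [integral_laplace_map_restrict, ← hlap, ← integral_laplace_map_restrict, integral_map hsum.aemeasurable
      (Measurable.aestronglyMeasurable (by fun_prop))]
    have hprod : ∀ x : Fin n → I → ℝ≥0,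
        Real.exp (-∑ i, (c i : ℝ) * ((∑ k, x k) i : ℝ≥0)) =
          ∏ k, Real.exp (-∑ i, (c i : ℝ) * x k i) := by
      intro x
      rw [← Real.exp_sum]
      congr 1
      rw [Finset.sum_neg_distrib, Finset.sum_comm]
      congr 1
      refine Finset.sum_congr rfl fun i _ => ?_
      rw [Finset.sum_apply, NNReal.coe_sum, Finset.mul_sum]
    simp only [hprod]
    rw [integral_fintype_prod_eq_pow (fun y : I → ℝ≥0 => Real.exp (-∑ i, (c i : ℝ) * y i))]
    simp
  have h1 : μ.map (fun y (t : I) => (y t : ℝ)) = (μ.map I.restrict).map coe :=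
    (Measure.map_map hcoe hres).symm
  have : IsProbabilityMeasure ((ρ.map I.restrict).map coe) :=
    Measure.isProbabilityMeasure_map hcoe.aemeasurable
  rw [h1, hkey, Measure.map_map hcoe hsum,
    ← Measure.pi_map_pi (μ := fun _ : Fin n => ρ.map I.restrict) (f := fun _ => coe)
      fun _ => hcoe.aemeasurable,
    Measure.map_map (by fun_prop) (by fun_prop)]
  congr 1
  funext x t
  simp [coe, Finset.sum_apply]

variable {Ω : Type*} [MeasurableSpace Ω] {P : Measure Ω} {ψ : ℝ≥0 → Ω → ℝ≥0} {α : ℝ}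

/-- A subordinator with its clock slowed by the factor `n` is a subordinator. -/
lemma IsSubordinator.comp_div (hψ : IsSubordinator P ψ) (n : ℝ≥0) :
    IsSubordinator P fun t => ψ (t / n) where
  measurable t := hψ.measurable _
  zero := by simpa using hψ.zero
  indep := fun k t ht => hψ.indep k (fun i => t i / n) fun _ _ hij =>
    div_le_div_of_nonneg_right (ht hij) zero_le
  stationary s t := by
    rw [add_div]
    exact hψ.stationary (s / n) (t / n)
  paths := by
    filter_upwards [hψ.paths] with ω hω
    have hmono : Monotone fun t : ℝ≥0 => t / n := fun _ _ h =>
      div_le_div_of_nonneg_right h zero_le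
    refine ⟨hω.1.comp hmono, fun t => ?_⟩
    exact ContinuousWithinAt.comp (g := fun t => ψ t ω) (f := fun t : ℝ≥0 => t / n)
      (hω.2 (t / n)) (by fun_prop) fun _ h => hmono h

lemma isProbabilityMeasure_pathLaw [IsProbabilityMeasure P] {X : ℝ≥0 → Ω → ℝ≥0}
    (hX : Measurable fun ω t => X t ω) : IsProbabilityMeasure (pathLaw P X) :=
  Measure.isProbabilityMeasure_map hX.aemeasurable

variable [IsProbabilityMeasure P]

lemma IsTemperedStableSubordinator.pathExp_past_div_pow (hψ : IsTemperedStableSubordinator P α ψ)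
    (hα : 0 ≤ α) (a : ℝ≥0) {n : ℕ} (hn : n ≠ 0) (I : Finset ℝ≥0) (c : ℝ≥0 → ℝ≥0) :
    (∫ y, pathExp I c y ∂(pathLaw P fun t ω => ψ (min t a / n) ω)) ^ n =
      ∫ y, pathExp I c y ∂(pathLaw P fun t ω => ψ (min t a) ω) := by
  rw [integral_pathLaw (measurable_pi_lambda _ fun t => hψ.measurable _) (measurable_pathExp I c),
    integral_pathLaw (hψ.measurable_past a) (measurable_pathExp I c)]
  exact hψ.integral_exp_sum_div_pow hα I (min · a) c hn

theorem IsTemperedStableSubordinator.isInfDivLaw_past (hψ : IsTemperedStableSubordinator P α ψ)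
    (hα : 0 ≤ α) (a : ℝ≥0) : IsInfDivLaw (pathLaw P fun t ω => ψ (min t a) ω) := by
  have := isProbabilityMeasure_pathLaw (P := P) (hψ.measurable_past a)
  refine isInfDivLaw_of_laplace_root fun n hn => ⟨pathLaw P fun t ω => ψ (min t a / n) ω, ?_, ?_⟩
  · exact isProbabilityMeasure_pathLaw (measurable_pi_lambda _ fun t => hψ.measurable _)
  · exact hψ.pathExp_past_div_pow hα a hn

/-- The root is the law of the increments after `a / n` of `ψ`, run at speed `1 / n`. Its functional
is a quotient of two functionals whose `n`-th powers are known. -/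
theorem IsTemperedStableSubordinator.isInfDivLaw_future (hψ : IsTemperedStableSubordinator P α ψ)
    (hα : 0 ≤ α) (a : ℝ≥0) : IsInfDivLaw (pathLaw P fun t ω => ψ (max t a) ω - ψ a ω) := by
  have := isProbabilityMeasure_pathLaw (P := P) (hψ.measurable_future a)
  refine isInfDivLaw_of_laplace_root fun n hn =>
    ⟨pathLaw P fun t ω => ψ (max t a / n) ω - ψ (a / n) ω, ?_, fun I c => ?_⟩
  · exact isProbabilityMeasure_pathLaw ((hψ.toIsSubordinator.comp_div n).measurable_future a)
  · have h1 := congrArg (· ^ n) ((hψ.toIsSubordinator.comp_div n).integral_pathExp_mul a I c)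
    have h2 := hψ.toIsSubordinator.integral_pathExp_mul a I c
    have h3 : (∫ y, pathExp I c y ∂(pathLaw P fun t ω => ψ (t / n) ω)) ^ n =
        ∫ y, pathExp I c y ∂(pathLaw P ψ) := by
      rw [integral_pathLaw (measurable_pi_lambda _ fun t => hψ.measurable _)
        (measurable_pathExp I c), integral_pathLaw (measurable_pi_lambda _ hψ.measurable)
        (measurable_pathExp I c)]
      exact hψ.integral_exp_sum_div_pow hα I id c hn
    simp only [mul_pow] at h1
    rw [hψ.pathExp_past_div_pow hα a hn] at h1
    have hne : ∫ y, pathExp I c y ∂(pathLaw P fun t ω => ψ (min t a) ω) ≠ 0 := by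
      rw [hψ.integral_pathExp_past hα]
      exact (Real.exp_pos _).ne'
    refine mul_left_cancel₀ hne ?_
    rw [← h1, ← h2]
    exact h3

end InfinitelyDivisible

/-! ### Conditioning on `ψ(a) = 0` and the complementary component. -/

section Conditioning

lemma IsCondLawAtZero.unique {μ κ κ' : Measure TimePath} {a : ℝ≥0} (h : IsCondLawAtZero μ a κ)
    (h' : IsCondLawAtZero μ a κ') : κ = κ' := by
  have := h.1
  have := h'.1
  refine ext_of_map_restrict fun I => ?_
  have hres : Measurable (I.restrict : TimePath → I → ℝ≥0) := by fun_prop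
  refine ext_of_forall_integral_eq_of_IsFiniteMeasure fun f => ?_
  rw [integral_map hres.aemeasurable f.continuous.aestronglyMeasurable,
    integral_map hres.aemeasurable f.continuous.aestronglyMeasurable]
  exact tendsto_nhds_unique (h.2 I f) (h'.2 I f)

variable {Ω : Type*} [MeasurableSpace Ω] {P : Measure Ω} [IsProbabilityMeasure P]
  {ψ : ℝ≥0 → Ω → ℝ≥0} {α : ℝ}

/-- If `ψ(a) > ε` almost surely, then `u ε ≤ a φ(u)` for all `u ≥ 0`, contradicting the sublinear
growth of `φ` for `α < 1`. The events conditioned on thus have positive probability. -/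
lemma IsTemperedStableSubordinator.measure_le_pos (hψ : IsTemperedStableSubordinator P α ψ)
    (hα : α < 1) (a : ℝ≥0) {ε : ℝ≥0} (hε : 0 < ε) : 0 < P {ω | ψ a ω ≤ ε} := by
  by_contra hP
  have hP0 : P {ω | ψ a ω ≤ ε} = 0 := le_antisymm (not_lt.1 hP) zero_le
  have hae : ∀ᵐ ω ∂P, ε < ψ a ω := by
    filter_upwards [measure_eq_zero_iff_ae_notMem.1 hP0] with ω hω
    exact not_le.1 hω
  have hbound : ∀ u : ℝ, 0 ≤ u → u * ε ≤ a * temperedExponent α u := by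
    intro u hu
    have h : ∫ ω, Real.exp (-(u * ψ a ω)) ∂P ≤ ∫ _, Real.exp (-(u * ε)) ∂P := by
      refine integral_mono_ae (integrable_exp_neg ((hψ.measurable a).coe_nnreal_real.const_mul u)
        (ae_of_all _ fun ω => by positivity)) (integrable_const _) ?_
      filter_upwards [hae] with ω hω
      have : (ε : ℝ) ≤ ψ a ω := NNReal.coe_le_coe.2 hω.le
      exact Real.exp_le_exp.2 (neg_le_neg (mul_le_mul_of_nonneg_left this hu))
    rw [hψ.integral_exp hu] at h
    simp only [integral_const, probReal_univ, one_smul] at h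
    linarith [Real.exp_le_exp.1 h]
  have hlim : Tendsto (fun v : ℝ => a * v ^ (-(1 - α))) atTop (𝓝 (a * 0)) :=
    (tendsto_rpow_neg_atTop (by linarith)).const_mul _
  rw [mul_zero] at hlim
  have hε' : (0 : ℝ) < ε := by exact_mod_cast hε
  -- With `v = 1 + u`, the choice of `v` makes `a v ^ α < v ε / 2`, while `v ≥ 2` gives `(v - 1) ε ≥
  -- v ε / 2`.
  obtain ⟨v, hv, hv2⟩ := ((hlim.eventually_lt_const (half_pos hε')).and (eventually_ge_atTop 2)).exists
  have h := hbound (v - 1) (by linarith)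
  have hv0 : 0 < v := by linarith
  have hpow : v ^ α = v * v ^ (-(1 - α)) := by
    nth_rewrite 2 [← Real.rpow_one v]
    rw [← Real.rpow_add hv0]
    congr 1; ring
  rw [temperedExponent, show 1 + (v - 1) = v by ring, hpow] at h
  have ha := a.coe_nonneg
  nlinarith

lemma integral_comp_prodMk_of_indepFun {β γ : Type*} [MeasurableSpace β] [MeasurableSpace γ]
    {X : Ω → β} {Z : Ω → γ} (h : IndepFun X Z P) (hX : Measurable X) (hZ : Measurable Z)
    {f : β × γ → ℝ} (hf : Measurable f) {C : ℝ} (hC : ∀ p, ‖f p‖ ≤ C) :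
    ∫ ω, f (X ω, Z ω) ∂P = ∫ ω, ∫ z, f (X ω, z) ∂(P.map Z) ∂P := by
  have := Measure.isProbabilityMeasure_map (μ := P) hX.aemeasurable
  have := Measure.isProbabilityMeasure_map (μ := P) hZ.aemeasurable
  rw [← integral_map (hX.prodMk hZ).aemeasurable hf.aestronglyMeasurable,
    (indepFun_iff_map_prod_eq_prod_map_map hX.aemeasurable hZ.aemeasurable).1 h,
    integral_prod _ (Integrable.of_bound hf.aestronglyMeasurable C (ae_of_all _ hC)),
    integral_map hX.aemeasurable]
  exact (hf.stronglyMeasurable.integral_prod_right' (ν := P.map Z)).aestronglyMeasurable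

/-- Conditioning on `ψ(a) ≤ ε` and letting `ε ↓ 0` leaves the increments after `a`. -/
theorem IsTemperedStableSubordinator.isCondLawAtZero_future
    (hψ : IsTemperedStableSubordinator P α ψ) (hα : α < 1) (a : ℝ≥0) :
    IsCondLawAtZero (pathLaw P ψ) a (pathLaw P fun t ω => ψ (max t a) ω - ψ a ω) := by
  have hfutm := hψ.toIsSubordinator.measurable_future a
  have hpastm := hψ.toIsSubordinator.measurable_past a
  have hψm : Measurable fun ω t => ψ t ω := measurable_pi_lambda _ hψ.measurable
  have hκ := isProbabilityMeasure_pathLaw (P := P) hfutm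
  refine ⟨hκ, fun I f => ?_⟩
  set κ := pathLaw P fun t ω => ψ (max t a) ω - ψ a ω with hκdef
  have hfm : Measurable f := f.continuous.measurable
  -- `g x` averages `f` over the later increments with the stopped values fixed at `x`. By
  -- independence the conditional integral is the mean of `g` over `ψ(a) ≤ ε`, and continuity of `g`
  -- at `0` gives the limit.
  let g : (I → ℝ≥0) → ℝ := fun x => ∫ z, f (x + I.restrict z) ∂κ
  have hg : Continuous g := by
    refine continuous_of_dominated (bound := fun _ => ‖f‖) ?_ ?_ (integrable_const _) ?_
    · intro x
      exact (hfm.comp (by fun_prop)).aestronglyMeasurable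
    · exact fun x => ae_of_all _ fun z => f.norm_coe_le_norm _
    · exact ae_of_all _ fun z => f.continuous.comp (by fun_prop)
  have hg0 : ∫ y, f (I.restrict y) ∂κ = g 0 := by simp [g]
  have hset : ∀ ε : ℝ≥0, MeasurableSet {y : TimePath | y a ≤ ε} := fun ε =>
    measurableSet_le (measurable_pi_apply a) measurable_const
  have hA : ∀ ε : ℝ≥0, MeasurableSet {ω | ψ a ω ≤ ε} := fun ε =>
    measurableSet_le (hψ.measurable a) measurable_const
  have hint : ∀ ε : ℝ≥0, ∫ y, f (I.restrict y) ∂((pathLaw P ψ)[|{y : TimePath | y a ≤ ε}]) =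
      (P.real {ω | ψ a ω ≤ ε})⁻¹ * ∫ ω in {ω | ψ a ω ≤ ε}, g (fun t => ψ (min t a) ω) ∂P := by
    intro ε
    have h1 : pathLaw P ψ {y : TimePath | y a ≤ ε} = P {ω | ψ a ω ≤ ε} :=
      Measure.map_apply hψm (hset ε)
    have h2 : ∫ y in {y : TimePath | y a ≤ ε}, f (I.restrict y) ∂(pathLaw P ψ) =
        ∫ ω in {ω | ψ a ω ≤ ε}, f (fun t => ψ t ω) ∂P :=
      setIntegral_map (hset ε) (hfm.comp (by fun_prop)).aestronglyMeasurable hψm.aemeasurable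
    rw [ProbabilityTheory.cond, integral_smul_measure, h1, h2, ENNReal.toReal_inv, smul_eq_mul,
      Measure.real]
    congr 1
    have h3 := integral_comp_prodMk_of_indepFun (hψ.toIsSubordinator.indepFun_past_future a) hpastm
      hfutm (f := fun p : TimePath × TimePath => {y : TimePath | y a ≤ ε}.indicator
        (fun y => f (I.restrict y + I.restrict p.2)) p.1) (C := ‖f‖)
      (by
        have : (fun p : TimePath × TimePath => {y : TimePath | y a ≤ ε}.indicator
            (fun y => f (I.restrict y + I.restrict p.2)) p.1) =
            (Prod.fst ⁻¹' {y : TimePath | y a ≤ ε}).indicator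
              fun p : TimePath × TimePath => f (I.restrict p.1 + I.restrict p.2) := by
          funext p; simp [indicator_apply]
        rw [this]
        exact (hfm.comp (by fun_prop)).indicator (measurable_fst (hset ε)))
      (fun p => by
        rw [norm_indicator_eq_indicator_norm]
        exact indicator_le' (fun _ _ => f.norm_coe_le_norm _) (fun _ _ => norm_nonneg _) _)
    rw [← integral_indicator (hA ε), ← integral_indicator (hA ε)]
    refine Eq.trans (integral_congr_ae ?_) (h3.trans (integral_congr_ae (ae_of_all _ fun ω => ?_)))
    · filter_upwards [hψ.toIsSubordinator.past_add_future a] with ω hω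
      simp only [indicator_apply, mem_ofPred_eq, min_self]
      split_ifs
      · congr 1
        funext t
        exact (hω t).symm
      · rfl
    · simp only [indicator_apply, mem_ofPred_eq, min_self]
      split_ifs
      · rfl
      · simp
  simp only [hint, hg0]
  rw [Metric.tendsto_nhds]
  intro δ hδ
  obtain ⟨r, hr, hgr⟩ := Metric.continuousAt_iff.1 (hg.continuousAt (x := 0)) (δ / 2) (half_pos hδ)
  have hev : ∀ᶠ ε in 𝓝[>] (0 : ℝ≥0), ε ∈ Ioo 0 r.toNNReal :=
    Ioo_mem_nhdsGT (Real.toNNReal_pos.2 hr)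
  filter_upwards [hev] with ε hε
  have hp : 0 < P.real {ω | ψ a ω ≤ ε} :=
    ENNReal.toReal_pos (hψ.measure_le_pos hα a hε.1).ne' (measure_ne_top _ _)
  have hgm : Measurable fun ω => g (fun t => ψ (min t a) ω) :=
    hg.measurable.comp (measurable_pi_lambda _ fun t => hψ.measurable _)
  have hgb : ∀ x, ‖g x‖ ≤ ‖f‖ := fun x => by
    refine (norm_integral_le_of_norm_le_const (ae_of_all _ fun z => f.norm_coe_le_norm _)).trans ?_
    simp
  have hgi : Integrable (fun ω => g (fun t => ψ (min t a) ω)) (P.restrict {ω | ψ a ω ≤ ε}) :=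
    Integrable.of_bound hgm.aestronglyMeasurable ‖f‖ (ae_of_all _ fun ω => hgb _)
  have hdiff : (P.real {ω | ψ a ω ≤ ε})⁻¹ * ∫ ω in {ω | ψ a ω ≤ ε}, g (fun t => ψ (min t a) ω) ∂P -
      g 0 = (P.real {ω | ψ a ω ≤ ε})⁻¹ *
        ∫ ω in {ω | ψ a ω ≤ ε}, (g (fun t => ψ (min t a) ω) - g 0) ∂P := by
    rw [integral_sub hgi (integrable_const _), integral_const, measureReal_restrict_apply_univ,
      smul_eq_mul, mul_sub, inv_mul_cancel_left₀ hp.ne']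
  have hbd : ‖∫ ω in {ω | ψ a ω ≤ ε}, (g (fun t => ψ (min t a) ω) - g 0) ∂P‖ ≤
      δ / 2 * P.real {ω | ψ a ω ≤ ε} := by
    refine norm_setIntegral_le_of_norm_le_const_ae' (measure_lt_top _ _) ?_
    filter_upwards [hψ.paths] with ω hω hωA
    rw [← dist_eq_norm]
    -- Monotone paths keep every stopped value below `ψ(a) ≤ ε < r`, uniformly over the times in
    -- `I`.
    refine (hgr ?_).le
    refine lt_of_le_of_lt ((dist_pi_le_iff ε.coe_nonneg).2 fun t => ?_)
      (Real.lt_toNNReal_iff_coe_lt.1 hε.2)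
    rw [NNReal.dist_eq]
    simp only [Pi.zero_apply, NNReal.coe_zero, sub_zero, NNReal.abs_eq, NNReal.coe_le_coe]
    exact (hω.1 (min_le_right _ _)).trans hωA
  rw [dist_eq_norm, hdiff, norm_mul, norm_inv, Real.norm_of_nonneg hp.le]
  calc _ ≤ (P.real {ω | ψ a ω ≤ ε})⁻¹ * (δ / 2 * P.real {ω | ψ a ω ≤ ε}) := by gcongr
    _ = δ / 2 := by field_simp
    _ < δ := half_lt_self hδ

theorem IsTemperedStableSubordinator.isCondLawAtZero_iff
    (hψ : IsTemperedStableSubordinator P α ψ) (hα : α < 1) (a : ℝ≥0) (κ : Measure TimePath) :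
    IsCondLawAtZero (pathLaw P ψ) a κ ↔ κ = pathLaw P fun t ω => ψ (max t a) ω - ψ a ω := by
  refine ⟨fun h => h.unique (hψ.isCondLawAtZero_future hα a), ?_⟩
  rintro rfl
  exact hψ.isCondLawAtZero_future hα a

lemma integral_pathExp_map_add (κ η : Measure TimePath) [IsProbabilityMeasure κ]
    [IsProbabilityMeasure η] (I : Finset ℝ≥0) (c : ℝ≥0 → ℝ≥0) :
    ∫ y, pathExp I c y ∂((κ.prod η).map fun p => p.1 + p.2) =
      (∫ y, pathExp I c y ∂κ) * ∫ y, pathExp I c y ∂η := by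
  rw [integral_map (by fun_prop) (by fun_prop)]
  simp only [pathExp_add]
  exact integral_prod_mul _ _

/-- The conditional law is forced to be that of the later increments, and its Laplace functional is
positive, so it cancels from the convolution identity. -/
theorem IsTemperedStableSubordinator.isComplementLaw_iff
    (hψ : IsTemperedStableSubordinator P α ψ) (hα : α ∈ Ioo (0 : ℝ) 1) (a : ℝ≥0)
    (η : Measure TimePath) :
    IsComplementLaw (pathLaw P ψ) a η ↔ η = pathLaw P fun t ω => ψ (min t a) ω := by
  have hκ := isProbabilityMeasure_pathLaw (P := P) (hψ.toIsSubordinator.measurable_future a)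
  have hη := isProbabilityMeasure_pathLaw (P := P) (hψ.toIsSubordinator.measurable_past a)
  have hμ := isProbabilityMeasure_pathLaw (P := P) (measurable_pi_lambda _ hψ.measurable)
  have hfac := hψ.toIsSubordinator.integral_pathExp_mul a
  constructor
  · rintro ⟨⟨hη', -⟩, κ, hcond, -, hadd⟩
    rw [hψ.isCondLawAtZero_iff hα.2] at hcond
    subst hcond
    refine ext_of_integral_pathExp fun I c => ?_
    have h := integral_pathExp_map_add (pathLaw P fun t ω => ψ (max t a) ω - ψ a ω) η I c
    rw [hadd, hfac, mul_comm] at h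
    refine (mul_left_cancel₀ ?_ h).symm
    rw [hψ.integral_pathExp_future hα.1.le]
    exact (Real.exp_pos _).ne'
  · rintro rfl
    refine ⟨hψ.isInfDivLaw_past hα.1.le a, _, hψ.isCondLawAtZero_future hα.2 a,
      hψ.isInfDivLaw_future hα.1.le a, ?_⟩
    have : IsProbabilityMeasure (((pathLaw P fun t ω => ψ (max t a) ω - ψ a ω).prod
        (pathLaw P fun t ω => ψ (min t a) ω)).map fun p => p.1 + p.2) :=
      Measure.isProbabilityMeasure_map (by fun_prop)
    refine ext_of_integral_pathExp fun I c => ?_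
    rw [integral_pathExp_map_add, hfac, mul_comm]

end Conditioning

/-! ### Gamma, exponential and uniform integrals. -/

section GammaLaws

lemma lintegral_gammaMeasure {b : ℝ} {f : ℝ → ℝ≥0∞} (hf : Measurable f) :
    ∫⁻ x, f x ∂(gammaMeasure b 1) = ENNReal.ofReal (Real.Gamma b)⁻¹ *
      ∫⁻ x in Ioi (0 : ℝ), f x * ENNReal.ofReal (x ^ (b - 1) * Real.exp (-x)) := by
  have hpdf : Measurable (gammaPDF b 1) := (measurable_gammaPDFReal b 1).ennreal_ofReal
  rw [gammaMeasure, lintegral_withDensity_eq_lintegral_mul _ hpdf hf,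
    ← setLIntegral_eq_of_support_subset (s := Ici 0), ← setLIntegral_congr Ioi_ae_eq_Ici,
    ← lintegral_const_mul _ (by fun_prop)]
  · refine setLIntegral_congr_fun measurableSet_Ioi fun x (hx : 0 < x) => ?_
    rw [Pi.mul_apply, gammaPDF_of_nonneg hx.le, Real.one_rpow, one_div, one_mul, mul_assoc,
      ENNReal.ofReal_mul' (by positivity)]
    ring
  · intro x hx
    by_contra hneg
    refine hx ?_
    rw [Pi.mul_apply, gammaPDF_of_neg (not_le.1 hneg), zero_mul]

lemma integral_exp_gammaMeasure {b u : ℝ} (hb : 0 < b) (hu : 0 ≤ u) :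
    ∫ x, Real.exp (-(u * x)) ∂(gammaMeasure b 1) = (1 + u) ^ (-b) := by
  have hu1 : 0 < 1 + u := by linarith
  have hΓ := Real.Gamma_pos_of_pos hb
  rw [integral_eq_lintegral_of_nonneg_ae (ae_of_all _ fun x => by positivity)
    (Measurable.aestronglyMeasurable (by fun_prop)), lintegral_gammaMeasure (by fun_prop)]
  have : ∫⁻ x in Ioi (0 : ℝ), ENNReal.ofReal (Real.exp (-(u * x))) *
      ENNReal.ofReal (x ^ (b - 1) * Real.exp (-x)) =
      ∫⁻ x in Ioi (0 : ℝ), ENNReal.ofReal (x ^ (b - 1) * Real.exp (-((1 + u) * x))) := by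
    refine setLIntegral_congr_fun measurableSet_Ioi fun x (hx : 0 < x) => ?_
    rw [← ENNReal.ofReal_mul (by positivity)]
    congr 1
    rw [show -((1 + u) * x) = -(u * x) + -x by ring, Real.exp_add]
    ring
  rw [this, lintegral_rpow_mul_exp_neg_mul_Ioi hb hu1, ← ENNReal.ofReal_mul (by positivity),
    ENNReal.toReal_ofReal (by positivity), one_div, Real.inv_rpow hu1.le, ← Real.rpow_neg hu1.le]
  field_simp

/-- If `U` is uniform on `[0, 1]` and `Y` standard exponential, `Y e ^ (UY)` is the density that
turns the law of `UY` into Lebesgue measure on `(0, ∞)`. -/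
lemma lintegral_expMeasure_uniform {h : ℝ → ℝ≥0∞} (hh : Measurable h) :
    ∫⁻ y, (∫⁻ u in Icc (0 : ℝ) 1, ENNReal.ofReal (y * Real.exp (u * y)) * h (u * y))
      ∂(expMeasure 1) = ∫⁻ s in Ioi (0 : ℝ), h s := by
  have hmeas : Measurable fun y : ℝ => ∫⁻ u in Icc (0 : ℝ) 1,
      ENNReal.ofReal (y * Real.exp (u * y)) * h (u * y) :=
    Measurable.lintegral_prod_right'
      (f := fun p : ℝ × ℝ => ENNReal.ofReal (p.1 * Real.exp (p.2 * p.1)) * h (p.2 * p.1))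
      (by fun_prop)
  have hkey : Measurable fun p : ℝ × ℝ => (Ici p.2).indicator
      (fun y => ENNReal.ofReal (Real.exp p.2) * h p.2 * ENNReal.ofReal (Real.exp (-y))) p.1 := by
    have : (fun p : ℝ × ℝ => (Ici p.2).indicator (fun y => ENNReal.ofReal (Real.exp p.2) * h p.2 *
        ENNReal.ofReal (Real.exp (-y))) p.1) = {p : ℝ × ℝ | p.2 ≤ p.1}.indicator
        fun p => ENNReal.ofReal (Real.exp p.2) * h p.2 * ENNReal.ofReal (Real.exp (-p.1)) := by
      funext p; simp [indicator_apply]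
    rw [this]
    exact Measurable.indicator (by fun_prop) (measurableSet_le measurable_snd measurable_fst)
  rw [expMeasure, lintegral_gammaMeasure hmeas, Real.Gamma_one, inv_one, ENNReal.ofReal_one,
    one_mul]
  -- For fixed `y`, substituting `s = u y` gives the integral of `e ^ s h(s)` over `[0, y]`. After
  -- swapping, `∫ e ^ (-y) dy` over `y ≥ s` cancels `e ^ s`.
  have hinner : ∀ y ∈ Ioi (0 : ℝ), (∫⁻ u in Icc (0 : ℝ) 1,
      ENNReal.ofReal (y * Real.exp (u * y)) * h (u * y)) *
        ENNReal.ofReal (y ^ ((1 : ℝ) - 1) * Real.exp (-y)) =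
      ∫⁻ s in Ioi (0 : ℝ), (Ici s).indicator
        (fun y => ENNReal.ofReal (Real.exp s) * h s * ENNReal.ofReal (Real.exp (-y))) y := by
    intro y (hy : 0 < y)
    have himage : (fun u : ℝ => u * y) '' Icc 0 1 = Icc 0 y := by
      rw [image_mul_right_Icc zero_le_one hy.le]; simp
    have hcov := lintegral_image_eq_lintegral_abs_deriv_mul (s := Icc (0 : ℝ) 1) measurableSet_Icc
      (f := fun u => u * y) (f' := fun _ => y)
      (fun u _ => by simpa using ((hasDerivAt_id u).mul_const y).hasDerivWithinAt)
      (mul_left_injective₀ hy.ne').injOn (fun s => ENNReal.ofReal (Real.exp s) * h s)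
    rw [himage] at hcov
    have hl : ∫⁻ u in Icc (0 : ℝ) 1, ENNReal.ofReal (y * Real.exp (u * y)) * h (u * y) =
        ∫⁻ s in Icc 0 y, ENNReal.ofReal (Real.exp s) * h s := by
      rw [hcov]
      refine lintegral_congr fun u => ?_
      rw [abs_of_pos hy, ENNReal.ofReal_mul hy.le, mul_assoc]
    rw [hl, sub_self, Real.rpow_zero, one_mul, ← setLIntegral_congr Ioc_ae_eq_Icc,
      ← lintegral_mul_const _ (by fun_prop), ← Ioi_inter_Iic, inter_comm,
      ← setLIntegral_indicator measurableSet_Iic]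
    refine lintegral_congr fun s => ?_
    simp [indicator_apply]
  rw [setLIntegral_congr_fun measurableSet_Ioi hinner,
    lintegral_lintegral_swap hkey.aemeasurable]
  refine setLIntegral_congr_fun measurableSet_Ioi fun s (hs : 0 < s) => ?_
  have hexp : ∫⁻ y in Ioi s, ENNReal.ofReal (Real.exp (-y)) = ENNReal.ofReal (Real.exp (-s)) := by
    rw [← integral_exp_neg_Ioi s, ofReal_integral_eq_lintegral_ofReal (integrableOn_exp_neg_Ioi s)
      (ae_of_all _ fun y => by positivity)]
  rw [setLIntegral_indicator measurableSet_Ici,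
    inter_eq_left.2 (Ici_subset_Ioi.2 hs), ← setLIntegral_congr Ioi_ae_eq_Ici,
    lintegral_const_mul _ (by fun_prop), hexp, mul_assoc, mul_comm (h s), ← mul_assoc,
    ← ENNReal.ofReal_mul (Real.exp_pos s).le, ← Real.exp_add]
  simp

end GammaLaws

/-! ### Representation of the Lévy measure by `G`, `U` and `Y`. -/

section LevyMeasureRepresentation

variable {Ω' : Type*} [MeasurableSpace Ω'] {P' : Measure Ω'} {α : ℝ}

lemma aemeasurable_of_coe {G : Ω' → ℝ≥0} (h : AEMeasurable (fun ω => (G ω : ℝ)) P') :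
    AEMeasurable G P' := by
  simpa using h.real_toNNReal

/-- The probabilistic representation of the Lévy measure of the tempered stable subordinator. -/
theorem lintegral_representation_eq_temperedJumpIntegral
    [IsProbabilityMeasure P'] (hα : α ∈ Ioo (0 : ℝ) 1) {G U Y : Ω' → ℝ≥0}
    (hG : HasLaw (fun ω => (G ω : ℝ)) (gammaMeasure (1 - α) 1) P')
    (hU : HasLaw (fun ω => (U ω : ℝ)) (volume.restrict (Icc 0 1)) P')
    (hY : HasLaw (fun ω => (Y ω : ℝ)) (expMeasure 1) P')
    (hind : iIndepFun ![G, U, Y] P') {F : TimePath → ℝ≥0∞} (hF : Measurable F) :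
    ENNReal.ofReal α * ∫⁻ ω, ENNReal.ofReal ((G ω : ℝ)⁻¹ * Y ω * Real.exp (U ω * Y ω)) *
      F (stepPath (G ω) (U ω * Y ω)) ∂P' = temperedJumpIntegral α (Ioi 0) F := by
  have hΓ : 0 < Real.Gamma (1 - α) := Real.Gamma_pos_of_pos (by linarith [hα.2])
  have hGm := aemeasurable_of_coe hG.aemeasurable
  have hUm := aemeasurable_of_coe hU.aemeasurable
  have hYm := aemeasurable_of_coe hY.aemeasurable
  have hc : Measurable fun x : ℝ≥0 => (x : ℝ) := by fun_prop
  have hYU : IndepFun (fun ω => (Y ω : ℝ)) (fun ω => (U ω : ℝ)) P' :=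
    (hind.indepFun (i := 2) (j := 1) (by decide)).comp hc hc
  have hGYU : IndepFun (fun ω => (G ω : ℝ)) (fun ω => ((Y ω : ℝ), (U ω : ℝ))) P' := by
    have h := hind.indepFun_prodMk₀ (fun i => by fin_cases i <;> assumption) 2 1 0
      (by decide) (by decide)
    exact (h.comp (φ := fun p : ℝ≥0 × ℝ≥0 => ((p.1 : ℝ), (p.2 : ℝ)))
      (ψ := fun x : ℝ≥0 => (x : ℝ)) (by fun_prop) hc).symm
  have hlaw : P'.map (fun ω => ((G ω : ℝ), ((Y ω : ℝ), (U ω : ℝ)))) =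
      (gammaMeasure (1 - α) 1).prod ((expMeasure 1).prod (volume.restrict (Icc 0 1))) := by
    rw [(indepFun_iff_map_prod_eq_prod_map_map hG.aemeasurable
      (hY.aemeasurable.prodMk hU.aemeasurable)).1 hGYU,
      (indepFun_iff_map_prod_eq_prod_map_map hY.aemeasurable hU.aemeasurable).1 hYU,
      hG.map_eq, hY.map_eq, hU.map_eq]
  let H : ℝ × ℝ × ℝ → ℝ≥0∞ := fun p => ENNReal.ofReal p.1⁻¹ *
    (ENNReal.ofReal (p.2.1 * Real.exp (p.2.2 * p.2.1)) *
      F (stepPath p.1.toNNReal (p.2.2 * p.2.1).toNNReal))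
  have hFs : Measurable fun p : ℝ × ℝ => F (stepPath p.2.toNNReal p.1.toNNReal) :=
    hF.comp measurable_stepPath_toNNReal
  have hH : Measurable H := by
    refine Measurable.mul (by fun_prop) (Measurable.mul (by fun_prop) ?_)
    exact hFs.comp (f := fun p : ℝ × ℝ × ℝ => (p.2.2 * p.2.1, p.1)) (by fun_prop)
  have hlhs : ∫⁻ ω, ENNReal.ofReal ((G ω : ℝ)⁻¹ * Y ω * Real.exp (U ω * Y ω)) *
      F (stepPath (G ω) (U ω * Y ω)) ∂P' =
      ∫⁻ ω, H ((G ω : ℝ), ((Y ω : ℝ), (U ω : ℝ))) ∂P' := by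
    refine lintegral_congr fun ω => ?_
    simp only [H]
    rw [mul_assoc (G ω : ℝ)⁻¹, ENNReal.ofReal_mul (by positivity), ← mul_assoc,
      ← NNReal.coe_mul, Real.toNNReal_coe, Real.toNNReal_coe]
  have : IsProbabilityMeasure (expMeasure 1) := isProbabilityMeasure_expMeasure one_pos
  rw [hlhs, ← lintegral_map' hH.aemeasurable
    (hG.aemeasurable.prodMk (hY.aemeasurable.prodMk hU.aemeasurable)), hlaw,
    lintegral_prod _ hH.aemeasurable]
  have hinner : ∀ g : ℝ, ∫⁻ q, H (g, q) ∂((expMeasure 1).prod (volume.restrict (Icc 0 1))) =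
      ENNReal.ofReal g⁻¹ * ∫⁻ s in Ioi (0 : ℝ), F (stepPath g.toNNReal s.toNNReal) := by
    intro g
    have hm : Measurable fun s : ℝ => F (stepPath g.toNNReal s.toNNReal) :=
      hFs.comp (measurable_id.prodMk measurable_const)
    have hm' : Measurable fun q : ℝ × ℝ => ENNReal.ofReal (q.1 * Real.exp (q.2 * q.1)) *
        F (stepPath g.toNNReal (q.2 * q.1).toNNReal) :=
      Measurable.mul (by fun_prop) (hm.comp (f := fun q : ℝ × ℝ => q.2 * q.1) (by fun_prop))
    rw [← lintegral_expMeasure_uniform hm]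
    simp only [H]
    rw [lintegral_const_mul _ hm', lintegral_prod _ hm'.aemeasurable]
  simp only [hinner]
  have hm1 : Measurable fun g : ℝ => ∫⁻ s in Ioi (0 : ℝ), F (stepPath g.toNNReal s.toNNReal) :=
    Measurable.lintegral_prod_left' hFs
  -- The constants match because `α / Γ(1 - α) = 1 / |Γ(-α)|`; the factor `g⁻¹` lowers the power
  -- from `-α` to `-α - 1`.
  rw [lintegral_gammaMeasure (by fun_prop), temperedJumpIntegral, ← mul_assoc,
    ← ENNReal.ofReal_mul hα.1.le, abs_Gamma_neg hα,
    show α * (Real.Gamma (1 - α))⁻¹ = 1 / (Real.Gamma (1 - α) / α) by rw [one_div_div]; rfl]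
  congr 1
  rw [lintegral_lintegral_swap]
  · refine setLIntegral_congr_fun measurableSet_Ioi fun x (hx : 0 < x) => ?_
    have hm : Measurable fun s : ℝ => F (stepPath x.toNNReal s.toNNReal) :=
      hFs.comp (measurable_id.prodMk measurable_const)
    rw [lintegral_mul_const _ hm, mul_comm (ENNReal.ofReal x⁻¹), mul_assoc, ← ENNReal.ofReal_mul (by positivity), ← mul_assoc]
    congr 3
    rw [← Real.rpow_neg_one, ← Real.rpow_add hx]
    congr 1
    ring
  · exact (hFs.mul ((measurable_temperedDensity α).comp measurable_snd)).aemeasurable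

end LevyMeasureRepresentation

/-! ### Size-biasing as differentiation of the Laplace functional. -/

section SizeBiasing

/-- Along dyadic steps the difference quotients of `1 - e ^ (-dz)` increase, so monotone convergence
applies without knowing beforehand that `ψ(a)` is integrable. -/
lemma HasDerivAt.tendsto_dyadic_slope {f : ℝ → ℝ} {f' : ℝ} (h : HasDerivAt f f' 0) :
    Tendsto (fun n : ℕ => (((1 : ℝ) / 2) ^ n)⁻¹ * (f ((1 / 2) ^ n) - f 0)) atTop (𝓝 f') := by
  have hseq : Tendsto (fun n : ℕ => ((1 : ℝ) / 2) ^ n) atTop (𝓝[≠] 0) :=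
    tendsto_nhdsWithin_iff.2 ⟨tendsto_pow_atTop_nhds_zero_of_lt_one (by norm_num) (by norm_num),
      Eventually.of_forall fun n => (by positivity : ((1 : ℝ) / 2) ^ n ≠ 0)⟩
  simpa only [Function.comp_def, smul_eq_mul, zero_add] using h.tendsto_slope_zero.comp hseq

lemma tendsto_dyadic_one_sub_exp (z : ℝ) :
    Tendsto (fun n : ℕ => (((1 : ℝ) / 2) ^ n)⁻¹ * (1 - Real.exp (-((1 / 2) ^ n * z)))) atTop
      (𝓝 z) := by
  have h : HasDerivAt (fun d : ℝ => 1 - Real.exp (-(d * z))) z 0 := by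
    have := ((((hasDerivAt_id (0 : ℝ)).mul_const z).neg).exp).const_sub 1
    convert! this using 1
    simp
  simpa using h.tendsto_dyadic_slope

/-- Halving the step replaces `1 - w ^ 2` by `2 (1 - w)`, which is larger by `(1 - w) ^ 2`. -/
lemma monotone_dyadic_one_sub_exp (z : ℝ) :
    Monotone fun n : ℕ => (((1 : ℝ) / 2) ^ n)⁻¹ * (1 - Real.exp (-((1 / 2) ^ n * z))) := by
  refine monotone_nat_of_le_succ fun n => ?_
  set w := Real.exp (-((1 / 2) ^ (n + 1) * z)) with hw
  have h1 : Real.exp (-((1 / 2) ^ n * z)) = w * w := by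
    rw [hw, ← Real.exp_add]; congr 1; ring
  have h2 : (((1 : ℝ) / 2) ^ (n + 1))⁻¹ = (((1 : ℝ) / 2) ^ n)⁻¹ * 2 := by
    rw [pow_succ, mul_inv]; norm_num
  rw [h1, h2, mul_assoc]
  gcongr
  nlinarith [sq_nonneg (1 - w)]

/-- The derivative of the Laplace exponent in the weight of a time `a`. -/
lemma hasDerivAt_integral_temperedExponent {α : ℝ} (hα : α ∈ Ioo (0 : ℝ) 1) (I : Finset ℝ≥0)
    (c : ℝ≥0 → ℝ≥0) (a : ℝ≥0) :
    HasDerivAt (fun d : ℝ => ∫ x in (0 : ℝ)..a, temperedExponent α (d + tailWeight I id c x))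
      (∫ x in (0 : ℝ)..a, α * (1 + tailWeight I id c x) ^ (α - 1)) 0 := by
  have hC := tailWeight_nonneg I id c
  have hmeas : ∀ d : ℝ, Measurable fun x => temperedExponent α (d + tailWeight I id c x) := by
    intro d
    unfold temperedExponent
    fun_prop
  -- Radius `1 / 2` keeps the base `1 + d + C(x)` at least `1 / 2`, so a constant dominates the
  -- derivative, whose power `α - 1` is negative.
  have h := intervalIntegral.hasDerivAt_integral_of_dominated_loc_of_deriv_le (μ := volume)
    (a := 0) (b := (a : ℝ)) (x₀ := (0 : ℝ)) (s := Metric.ball 0 (1 / 2))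
    (F := fun d x => temperedExponent α (d + tailWeight I id c x))
    (F' := fun d x => α * (1 + (d + tailWeight I id c x)) ^ (α - 1))
    (bound := fun _ => α * (1 / 2) ^ (α - 1))
    (Metric.ball_mem_nhds 0 (by norm_num))
    (Eventually.of_forall fun d => (hmeas d).aestronglyMeasurable)
    ((antitone_temperedExponent_tailWeight I id c hα.1.le le_rfl).intervalIntegrable)
    (Measurable.aestronglyMeasurable (by fun_prop))
    (ae_of_all _ fun x _ d hd => ?_)
    intervalIntegrable_const
    (ae_of_all _ fun x _ d hd => ?_)
  · simpa using h.2
  · have hd' : -(1 / 2) < d := by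
      have := abs_lt.1 (by simpa using hd : |d| < 2⁻¹); linarith [this.1]
    have hpos : 1 / 2 ≤ 1 + (d + tailWeight I id c x) := by linarith [hC x]
    rw [norm_mul, Real.norm_of_nonneg hα.1.le,
      Real.norm_of_nonneg (Real.rpow_nonneg (by linarith) _)]
    exact mul_le_mul_of_nonneg_left
      (Real.rpow_le_rpow_of_nonpos (by norm_num) hpos (by linarith [hα.2])) hα.1.le
  · have hd' : -(1 / 2) < d := by
      have := abs_lt.1 (by simpa using hd : |d| < 2⁻¹); linarith [this.1]
    have hpos : 0 < 1 + (d + tailWeight I id c x) := by linarith [hC x]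
    have := ((((hasDerivAt_id d).add_const (tailWeight I id c x)).const_add 1).rpow_const (p := α)
      (Or.inl hpos.ne')).sub_const 1
    convert! this using 1
    simp

variable {Ω : Type*} [MeasurableSpace Ω] {P : Measure Ω} [IsProbabilityMeasure P]
  {ψ : ℝ≥0 → Ω → ℝ≥0} {α : ℝ}

/-- A weight at `a` acts only on jumps up to `a`; the rest of the exponent is a constant `K`
independent of `d` and drops out on differentiating. -/
lemma IsTemperedStableSubordinator.integral_exp_mul_pathExp
    (hψ : IsTemperedStableSubordinator P α ψ) (hα : 0 ≤ α) (a : ℝ≥0) (I : Finset ℝ≥0)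
    (c : ℝ≥0 → ℝ≥0) : ∃ K : ℝ, ∀ d : ℝ≥0,
    ∫ ω, Real.exp (-(d * ψ a ω)) * pathExp I c (fun t => ψ t ω) ∂P =
      Real.exp (-((∫ x in (0 : ℝ)..a, temperedExponent α (d + tailWeight I id c x)) + K)) := by
  set r := max a (I.sup id)
  refine ⟨∫ x in (a : ℝ)..r, temperedExponent α (tailWeight I id c x), fun d => ?_⟩
  -- `none` indexes an extra copy of the time `a`, so `a` may also belong to `I`.
  let T : Option ℝ≥0 → ℝ≥0 := fun o => o.elim a id
  let w : Option ℝ≥0 → ℝ≥0 := fun o => o.elim d c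
  have h := hψ.integral_exp_sum hα (Finset.insertNone I) T w r (by
    intro o ho
    rcases o with _ | t
    · exact le_max_left _ _
    · exact (Finset.le_sup (f := id) (Finset.some_mem_insertNone.1 ho)).trans (le_max_right _ _))
  have htail : ∀ x, tailWeight (Finset.insertNone I) T w x =
      (if x ≤ a then (d : ℝ) else 0) + tailWeight I id c x := by
    intro x
    rw [tailWeight, Finset.sum_insertNone]
    rfl
  have hanti : Antitone fun x => temperedExponent α (tailWeight (Finset.insertNone I) T w x) := by
    simpa using antitone_temperedExponent_tailWeight (Finset.insertNone I) T w hα le_rfl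
  have hl : ∫ ω, Real.exp (-(d * ψ a ω)) * pathExp I c (fun t => ψ t ω) ∂P =
      ∫ ω, Real.exp (-∑ o ∈ Finset.insertNone I, (w o : ℝ) * ψ (T o) ω) ∂P := by
    refine integral_congr_ae (ae_of_all _ fun ω => ?_)
    simp only [pathExp, ← Real.exp_add, Finset.sum_insertNone, T, w, Option.elim, neg_add, id]
  have har : (a : ℝ) ≤ r := NNReal.coe_le_coe.2 (le_max_left _ _)
  rw [hl, h, ← intervalIntegral.integral_add_adjacent_intervals
    (hanti.intervalIntegrable (μ := volume) (a := 0) (b := (a : ℝ)))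
    (hanti.intervalIntegrable (μ := volume) (a := (a : ℝ)) (b := (r : ℝ)))]
  congr 3
  · refine intervalIntegral.integral_congr_ae (ae_of_all _ fun x hx => ?_)
    rw [uIoc_of_le a.coe_nonneg] at hx
    rw [htail, if_pos hx.2]
  · refine intervalIntegral.integral_congr_ae (ae_of_all _ fun x hx => ?_)
    rw [uIoc_of_le har] at hx
    rw [htail, if_neg (not_le.2 hx.1), zero_add]

/-- The Laplace functional of the size-biased law `E[ψ(a); ·]`. -/
theorem IsTemperedStableSubordinator.lintegral_mul_pathExp
    (hψ : IsTemperedStableSubordinator P α ψ) (hα : α ∈ Ioo (0 : ℝ) 1) (a : ℝ≥0)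
    (I : Finset ℝ≥0) (c : ℝ≥0 → ℝ≥0) :
    ∫⁻ ω, ENNReal.ofReal (ψ a ω * pathExp I c (fun t => ψ t ω)) ∂P =
      ENNReal.ofReal ((∫ x in (0 : ℝ)..a, α * (1 + tailWeight I id c x) ^ (α - 1)) *
        ∫ ω, pathExp I c (fun t => ψ t ω) ∂P) := by
  have hψm : Measurable fun ω t => ψ t ω := measurable_pi_lambda _ hψ.measurable
  have hem : Measurable fun ω => pathExp I c (fun t => ψ t ω) := (measurable_pathExp I c).comp hψm
  have ham := hψ.measurable a
  obtain ⟨K, hK⟩ := hψ.integral_exp_mul_pathExp hα.1.le a I c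
  have hpath0 : ∫ ω, pathExp I c (fun t => ψ t ω) ∂P =
      Real.exp (-((∫ x in (0 : ℝ)..a, temperedExponent α (0 + tailWeight I id c x)) + K)) := by
    simpa using hK 0
  have hpathi : Integrable (fun ω => pathExp I c (fun t => ψ t ω)) P :=
    Integrable.of_bound hem.aestronglyMeasurable 1 (ae_of_all _ fun ω => by
      rw [Real.norm_of_nonneg (pathExp_pos _ _ _).le]; exact pathExp_le_one _ _ _)
  have hexpi : ∀ d : ℝ≥0, Integrable
      (fun ω => Real.exp (-(d * ψ a ω)) * pathExp I c (fun t => ψ t ω)) P := fun d =>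
    Integrable.of_bound (Measurable.aestronglyMeasurable (by fun_prop)) 1 (ae_of_all _ fun ω => by
      rw [Real.norm_of_nonneg (mul_nonneg (Real.exp_pos _).le (pathExp_pos _ _ _).le)]
      refine mul_le_one₀ (Real.exp_le_one_iff.2 (neg_nonpos.2 (by positivity)))
        (pathExp_pos _ _ _).le (pathExp_le_one _ _ _))
  have hlim := lintegral_tendsto_of_tendsto_of_monotone (μ := P)
    (f := fun n ω => ENNReal.ofReal ((((1 : ℝ) / 2) ^ n)⁻¹ *
      (1 - Real.exp (-((1 / 2) ^ n * ψ a ω))) * pathExp I c (fun t => ψ t ω)))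
    (F := fun ω => ENNReal.ofReal (ψ a ω * pathExp I c (fun t => ψ t ω)))
    (fun n => Measurable.aemeasurable (by fun_prop))
    (ae_of_all _ fun ω m n hmn => ENNReal.ofReal_le_ofReal
      (mul_le_mul_of_nonneg_right (monotone_dyadic_one_sub_exp _ hmn) (pathExp_pos _ _ _).le))
    (ae_of_all _ fun ω => ENNReal.tendsto_ofReal ((tendsto_dyadic_one_sub_exp _).mul_const _))
  -- The same integrals are difference quotients at `d = 0` of minus the Laplace functional, so they
  -- also converge to its derivative.
  refine tendsto_nhds_unique hlim ?_
  have hderiv := (((hasDerivAt_integral_temperedExponent hα I c a).add_const K).neg.exp).neg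
  have hslope := hderiv.tendsto_dyadic_slope
  have hval : ∀ n : ℕ, ∫⁻ ω, ENNReal.ofReal ((((1 : ℝ) / 2) ^ n)⁻¹ *
      (1 - Real.exp (-((1 / 2) ^ n * ψ a ω))) * pathExp I c (fun t => ψ t ω)) ∂P =
      ENNReal.ofReal ((((1 : ℝ) / 2) ^ n)⁻¹ * (∫ ω, pathExp I c (fun t => ψ t ω) ∂P -
        Real.exp (-((∫ x in (0 : ℝ)..a,
          temperedExponent α ((1 / 2) ^ n + tailWeight I id c x)) + K)))) := by
    intro n
    have hKn := hK ((1 / 2) ^ n)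
    have hin := hexpi ((1 / 2) ^ n)
    push_cast at hKn hin
    have hsubi : Integrable (fun ω => pathExp I c (fun t => ψ t ω) -
        Real.exp (-((1 / 2) ^ n * ψ a ω)) * pathExp I c (fun t => ψ t ω)) P := hpathi.sub hin
    rw [← hKn, ← integral_sub hpathi hin, ← integral_const_mul,
      ofReal_integral_eq_lintegral_ofReal (hsubi.const_mul _)]
    · refine lintegral_congr fun ω => ?_
      congr 1
      ring
    · refine ae_of_all _ fun ω => ?_
      have h1 : Real.exp (-((1 / 2) ^ n * (ψ a ω : ℝ))) ≤ 1 :=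
        Real.exp_le_one_iff.2 (neg_nonpos.2 (by positivity))
      have h2 := pathExp_pos I c (fun t => ψ t ω)
      refine mul_nonneg (by positivity) (sub_nonneg.2 ?_)
      nlinarith
  simp only [hval]
  refine ENNReal.tendsto_ofReal ?_
  rw [hpath0]
  convert! hslope using 2
  · simp only [Pi.neg_apply]
    ring
  · simp only [Pi.neg_apply]
    ring

theorem IsTemperedStableSubordinator.lintegral_eq (hψ : IsTemperedStableSubordinator P α ψ)
    (hα : α ∈ Ioo (0 : ℝ) 1) (a : ℝ≥0) : ∫⁻ ω, ψ a ω ∂P = ENNReal.ofReal (α * a) := by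
  have h := hψ.lintegral_mul_pathExp hα a ∅ 0
  simpa [pathExp, tailWeight, mul_comm] using h

/-- The Laplace functional of the random step `G 1_{[aU, ∞)}`. -/
lemma integral_pathExp_random_step (hα : α ∈ Ioo (0 : ℝ) 1) {a : ℝ≥0} (ha : 0 < a)
    {G U : Ω → ℝ≥0} (hG : HasLaw (fun ω => (G ω : ℝ)) (gammaMeasure (1 - α) 1) P)
    (hU : HasLaw (fun ω => (U ω : ℝ)) (volume.restrict (Icc 0 1)) P) (hGU : IndepFun G U P)
    (I : Finset ℝ≥0) (c : ℝ≥0 → ℝ≥0) :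
    ∫ ω, pathExp I c (stepPath (G ω) (a * U ω)) ∂P =
      (a : ℝ)⁻¹ * ∫ x in (0 : ℝ)..a, (1 + tailWeight I id c x) ^ (α - 1) := by
  have hα' : 0 < 1 - α := by linarith [hα.2]
  have hc : Measurable fun x : ℝ≥0 => (x : ℝ) := by fun_prop
  have hind : IndepFun (fun ω => (U ω : ℝ)) (fun ω => (G ω : ℝ)) P := (hGU.comp hc hc).symm
  have hlaw := (indepFun_iff_map_prod_eq_prod_map_map hU.aemeasurable hG.aemeasurable).1 hind
  rw [hU.map_eq, hG.map_eq] at hlaw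
  have : IsProbabilityMeasure (gammaMeasure (1 - α) 1) :=
    isProbabilityMeasure_gammaMeasure hα' one_pos
  have hprob : IsProbabilityMeasure ((volume.restrict (Icc (0 : ℝ) 1)).prod
      (gammaMeasure (1 - α) 1)) := by
    rw [← hlaw]
    exact Measure.isProbabilityMeasure_map (hU.aemeasurable.prodMk hG.aemeasurable)
  -- Replacing the jump by its positive part keeps `H` bounded on the whole plane; the Gamma law
  -- does not charge negative values.
  let H : ℝ × ℝ → ℝ := fun p => Real.exp (-(tailWeight I id c (a * p.1) * max p.2 0))
  have hH : Measurable H := by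
    have := (measurable_tailWeight I id c).comp (f := fun p : ℝ × ℝ => (a : ℝ) * p.1) (by fun_prop)
    simp only [Function.comp_def] at this
    fun_prop
  have hHi : Integrable H ((volume.restrict (Icc (0 : ℝ) 1)).prod (gammaMeasure (1 - α) 1)) :=
    Integrable.of_bound hH.aestronglyMeasurable 1 (ae_of_all _ fun p => by
      rw [Real.norm_of_nonneg (Real.exp_pos _).le, Real.exp_le_one_iff, neg_nonpos]
      exact mul_nonneg (tailWeight_nonneg _ _ _ _) (le_max_right _ _))
  have h1 : ∫ ω, pathExp I c (stepPath (G ω) (a * U ω)) ∂P =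
      ∫ ω, H ((U ω : ℝ), (G ω : ℝ)) ∂P := by
    refine integral_congr_ae (ae_of_all _ fun ω => ?_)
    simp only [pathExp_stepPath, H, NNReal.coe_mul]
    rw [max_eq_left (G ω).coe_nonneg]
  have hG0 : ∀ᵐ g ∂(gammaMeasure (1 - α) 1), 0 ≤ g := by
    rw [← hG.map_eq, ae_map_iff hG.aemeasurable measurableSet_Ici]
    exact ae_of_all _ fun ω => (G ω).coe_nonneg
  have hinner : ∀ u : ℝ, ∫ g, H (u, g) ∂(gammaMeasure (1 - α) 1) =
      (1 + tailWeight I id c (a * u)) ^ (α - 1) := by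
    intro u
    rw [show α - 1 = -(1 - α) by ring,
      ← integral_exp_gammaMeasure hα' (tailWeight_nonneg I id c (a * u))]
    refine integral_congr_ae ?_
    filter_upwards [hG0] with g hg
    simp only [H, max_eq_left hg]
  rw [h1, ← integral_map (f := H) (hU.aemeasurable.prodMk hG.aemeasurable) hH.aestronglyMeasurable,
    hlaw, integral_prod H hHi]
  simp only [hinner]
  rw [integral_Icc_eq_integral_Ioc, ← intervalIntegral.integral_of_le zero_le_one,
    intervalIntegral.integral_comp_mul_left (fun x => (1 + tailWeight I id c x) ^ (α - 1))
      (by positivity : (a : ℝ) ≠ 0)]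
  simp

/-- Adding an independent `Gamma(1 - α, 1)` jump at a uniform time of `[0, a]` size-biases the
tempered stable subordinator by `ψ(a)`. -/
theorem IsTemperedStableSubordinator.pathLaw_add_random_step
    (hψ : IsTemperedStableSubordinator P α ψ) (hα : α ∈ Ioo (0 : ℝ) 1) {a : ℝ≥0} (ha : 0 < a)
    {G U : Ω → ℝ≥0} (hG : HasLaw (fun ω => (G ω : ℝ)) (gammaMeasure (1 - α) 1) P)
    (hU : HasLaw (fun ω => (U ω : ℝ)) (volume.restrict (Icc 0 1)) P) (hGU : IndepFun G U P)
    (hind : IndepFun (fun ω => (G ω, U ω)) (fun ω t => ψ t ω) P) :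
    pathLaw P (fun t ω => ψ t ω + stepPath (G ω) (a * U ω) t) =
      pathLaw (P.withDensity fun ω => ENNReal.ofReal (ψ a ω / (α * a))) ψ := by
  have hα0 := hα.1
  have ha' : (0 : ℝ) < a := by exact_mod_cast ha
  have hψm : Measurable fun ω t => ψ t ω := measurable_pi_lambda _ hψ.measurable
  have hdm : Measurable fun ω => ENNReal.ofReal (ψ a ω / (α * a)) :=
    ((hψ.measurable a).coe_nnreal_real.div_const _).ennreal_ofReal
  have hGm := aemeasurable_of_coe hG.aemeasurable
  have hUm := aemeasurable_of_coe hU.aemeasurable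
  have hstepm : Measurable fun p : ℝ≥0 × ℝ≥0 => stepPath p.1 (a * p.2) :=
    measurable_stepPath.comp (f := fun p : ℝ≥0 × ℝ≥0 => (p.1, a * p.2)) (by fun_prop)
  have hstep : AEMeasurable (fun ω => stepPath (G ω) (a * U ω)) P :=
    hstepm.comp_aemeasurable (hGm.prodMk hUm)
  have hsum : AEMeasurable (fun ω t => ψ t ω + stepPath (G ω) (a * U ω) t) P :=
    hψm.aemeasurable.add hstep
  have hint : Integrable (fun ω => (ψ a ω : ℝ)) P := by
    refine ⟨(hψ.measurable a).coe_nnreal_real.aestronglyMeasurable, ?_⟩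
    rw [hasFiniteIntegral_iff_ofReal (ae_of_all _ fun ω => (ψ a ω).coe_nonneg)]
    simp only [ENNReal.ofReal_coe_nnreal, hψ.lintegral_eq hα a]
    exact ENNReal.ofReal_lt_top
  have : IsFiniteMeasure (P.withDensity fun ω => ENNReal.ofReal (ψ a ω / (α * a))) :=
    isFiniteMeasure_withDensity_ofReal (hint.div_const _).2
  have : IsFiniteMeasure
      (pathLaw (P.withDensity fun ω => ENNReal.ofReal (ψ a ω / (α * a))) ψ) :=
    Measure.isFiniteMeasure_map _ _
  have : IsFiniteMeasure (pathLaw P (fun t ω => ψ t ω + stepPath (G ω) (a * U ω) t)) :=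
    Measure.isFiniteMeasure_map _ _
  refine ext_of_integral_pathExp fun I c => ?_
  have hem := measurable_pathExp I c
  have hleft : ∫ y, pathExp I c y ∂(pathLaw P (fun t ω => ψ t ω + stepPath (G ω) (a * U ω) t)) =
      (∫ ω, pathExp I c (stepPath (G ω) (a * U ω)) ∂P) * ∫ ω, pathExp I c (fun t => ψ t ω) ∂P := by
    rw [pathLaw, integral_map hsum hem.aestronglyMeasurable]
    have := (hind.comp (hem.comp hstepm) hem).integral_fun_mul_eq_mul_integral
      ((hem.comp hstepm).comp_aemeasurable (hGm.prodMk hUm)).aestronglyMeasurable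
      (hem.comp hψm).aestronglyMeasurable
    simp only [Function.comp_def] at this
    rw [← this]
    refine integral_congr_ae (ae_of_all _ fun ω => ?_)
    exact (pathExp_add I c _ _).trans (mul_comm _ _)
  have hright : ∫ y, pathExp I c y
      ∂(pathLaw (P.withDensity fun ω => ENNReal.ofReal (ψ a ω / (α * a))) ψ) =
      (α * a)⁻¹ * ((∫ x in (0 : ℝ)..a, α * (1 + tailWeight I id c x) ^ (α - 1)) *
        ∫ ω, pathExp I c (fun t => ψ t ω) ∂P) := by
    rw [integral_pathLaw hψm hem, integral_withDensity_eq_integral_toReal_smul hdm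
      (ae_of_all _ fun _ => ENNReal.ofReal_lt_top)]
    have h1 : ∀ ω, (ENNReal.ofReal (ψ a ω / (α * a))).toReal • pathExp I c (fun t => ψ t ω) =
        (α * a)⁻¹ * (ψ a ω * pathExp I c (fun t => ψ t ω)) := fun ω => by
      rw [ENNReal.toReal_ofReal (by positivity), smul_eq_mul]
      ring
    simp only [h1]
    rw [integral_const_mul, integral_eq_lintegral_of_nonneg_ae
      (ae_of_all _ fun ω => mul_nonneg (ψ a ω).coe_nonneg (pathExp_pos _ _ _).le)
      ((hψ.measurable a).coe_nnreal_real.mul (hem.comp hψm)).aestronglyMeasurable,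
      hψ.lintegral_mul_pathExp hα, ENNReal.toReal_ofReal]
    refine mul_nonneg (intervalIntegral.integral_nonneg ha'.le fun x _ => ?_)
      (integral_nonneg fun ω => (pathExp_pos _ _ _).le)
    have := tailWeight_nonneg I id c x
    positivity
  rw [hleft, hright, integral_pathExp_random_step hα ha hG hU hGU,
    intervalIntegral.integral_const_mul]
  field_simp

end SizeBiasing

/-! ### The Lévy measure as the law of a step process under a weighted measure. -/

section LevyMeasureLaw

lemma eq_pathLaw_withDensity_of_lintegral {Ω' : Type*} [MeasurableSpace Ω'] {P' : Measure Ω'}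
    {α : ℝ} (hα : 0 ≤ α) {G U Y : Ω' → ℝ≥0} (hG : AEMeasurable G P') (hU : AEMeasurable U P')
    (hY : AEMeasurable Y P') {ν : Measure TimePath}
    (h : ∀ F : TimePath → ℝ≥0∞, Measurable F → ∫⁻ y, F y ∂ν = ENNReal.ofReal α *
      ∫⁻ ω, ENNReal.ofReal ((G ω : ℝ)⁻¹ * Y ω * Real.exp (U ω * Y ω)) *
        F (stepPath (G ω) (U ω * Y ω)) ∂P') :
    ν = pathLaw
      (P'.withDensity fun ω => ENNReal.ofReal (α * (G ω : ℝ)⁻¹ * Y ω * Real.exp (U ω * Y ω)))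
      (fun t ω => stepPath (G ω) (U ω * Y ω) t) := by
  have hd : AEMeasurable
      (fun ω => ENNReal.ofReal (α * (G ω : ℝ)⁻¹ * Y ω * Real.exp (U ω * Y ω))) P' := by fun_prop
  have hstep : AEMeasurable (fun ω => stepPath (G ω) (U ω * Y ω)) P' :=
    measurable_stepPath.comp_aemeasurable (hG.prodMk (hU.mul hY))
  ext A hA
  have hF : Measurable (A.indicator (1 : TimePath → ℝ≥0∞)) := measurable_one.indicator hA
  have hcomp : AEMeasurable
      (fun ω => A.indicator (1 : TimePath → ℝ≥0∞) (stepPath (G ω) (U ω * Y ω))) P' :=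
    hF.comp_aemeasurable hstep
  rw [← lintegral_indicator_one hA, ← lintegral_indicator_one hA, h _ hF, pathLaw,
    lintegral_map' hF.aemeasurable (hstep.mono_ac (withDensity_absolutelyContinuous _ _)),
    lintegral_withDensity_eq_lintegral_mul₀ hd hcomp, ← lintegral_const_mul'' _ (by fun_prop)]
  refine lintegral_congr fun ω => ?_
  rw [← mul_assoc, ← ENNReal.ofReal_mul hα, Pi.mul_apply]
  simp only [mul_assoc]

end LevyMeasureLaw

/-! ### Assembly of the size-biasing, representation and conditioning statements. -/

theorem mainTheorem7 {Ω Ω' : Type*} [MeasurableSpace Ω] [MeasurableSpace Ω']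
    (P : Measure Ω) [IsProbabilityMeasure P] (P' : Measure Ω') [IsProbabilityMeasure P']
    (α : ℝ) (hα : α ∈ Ioo (0 : ℝ) 1)
    (ψ : ℝ≥0 → Ω → ℝ≥0) (hψ : IsTemperedStableSubordinator P α ψ) :
    -- (a4)
    (∀ (a : ℝ≥0), 0 < a → ∫⁻ ω, ψ a ω ∂P = ENNReal.ofReal (α * a) ∧
      ∀ (G U : Ω → ℝ≥0),
      HasLaw (fun ω => (G ω : ℝ)) (gammaMeasure (1 - α) 1) P →
      HasLaw (fun ω => (U ω : ℝ)) (volume.restrict (Icc 0 1)) P →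
      IndepFun G U P →
      IndepFun (fun ω => (G ω, U ω)) (fun ω t => ψ t ω) P →
      pathLaw P (fun t ω => ψ t ω + stepPath (G ω) (a * U ω) t) =
        pathLaw (P.withDensity fun ω => ENNReal.ofReal (ψ a ω / (α * a))) ψ) ∧
    -- (b4)
    (∃! ν, IsLevyMeasure (pathLaw P ψ) ν) ∧
    (∀ (G U Y : Ω' → ℝ≥0),
      HasLaw (fun ω => (G ω : ℝ)) (gammaMeasure (1 - α) 1) P' →
      HasLaw (fun ω => (U ω : ℝ)) (volume.restrict (Icc 0 1)) P' →
      HasLaw (fun ω => (Y ω : ℝ)) (expMeasure 1) P' →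
      iIndepFun ![G, U, Y] P' →
      ∀ ν, IsLevyMeasure (pathLaw P ψ) ν →
        (∀ F : TimePath → ℝ≥0∞, Measurable F →
          ∫⁻ y, F y ∂ν = ENNReal.ofReal α *
            ∫⁻ ω, ENNReal.ofReal ((G ω : ℝ)⁻¹ * Y ω * Real.exp (U ω * Y ω)) *
              F (stepPath (G ω) (U ω * Y ω)) ∂P') ∧
        ν = pathLaw
          (P'.withDensity fun ω =>
            ENNReal.ofReal (α * (G ω : ℝ)⁻¹ * Y ω * Real.exp (U ω * Y ω)))
          (fun t ω => stepPath (G ω) (U ω * Y ω) t)) ∧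
    -- (c4)
    (∀ (a : ℝ≥0), 0 < a →
      (∀ κ, IsCondLawAtZero (pathLaw P ψ) a κ ↔
        κ = pathLaw P (fun t ω => ψ (max t a) ω - ψ a ω)) ∧
      (∀ η, IsComplementLaw (pathLaw P ψ) a η ↔
        η = pathLaw P (fun t ω => ψ (min t a) ω)) ∧
      (∀ κ, IsCondLawAtZero (pathLaw P ψ) a κ →
        (∃! ν, IsLevyMeasure κ ν) ∧
        ∀ ν, IsLevyMeasure κ ν → ∀ F : TimePath → ℝ≥0∞, Measurable F →
          ∫⁻ y, F y ∂ν = temperedJumpIntegral α (Ioi (a : ℝ)) F) ∧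
      (∀ η, IsComplementLaw (pathLaw P ψ) a η →
        (∃! ν, IsLevyMeasure η ν) ∧
        ∀ ν, IsLevyMeasure η ν → ∀ F : TimePath → ℝ≥0∞, Measurable F →
          ∫⁻ y, F y ∂ν = temperedJumpIntegral α (Ioc 0 (a : ℝ)) F)) := by
  have hα0 := hα.1.le
  have hlevy : IsLevyMeasure (pathLaw P ψ) (temperedLevyMeasure α (Ioi 0)) :=
    isLevyMeasure_temperedLevyMeasure hα measurableSet_Ioi subset_rfl
      (hψ.integral_pathExp_pathLaw hα0)
  refine ⟨fun a ha => ⟨hψ.lintegral_eq hα a, fun G U hG hU hGU hind =>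
    hψ.pathLaw_add_random_step hα ha hG hU hGU hind⟩, hlevy.existsUnique, ?_, fun a _ =>
    ⟨hψ.isCondLawAtZero_iff hα.2 a, hψ.isComplementLaw_iff hα a, fun κ hκ => ?_, fun η hη => ?_⟩⟩
  · intro G U Y hG hU hY hind ν hν
    obtain rfl := hν.unique hlevy
    have hrep : ∀ F : TimePath → ℝ≥0∞, Measurable F →
        ∫⁻ y, F y ∂(temperedLevyMeasure α (Ioi 0)) = ENNReal.ofReal α *
          ∫⁻ ω, ENNReal.ofReal ((G ω : ℝ)⁻¹ * Y ω * Real.exp (U ω * Y ω)) *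
            F (stepPath (G ω) (U ω * Y ω)) ∂P' := fun F hF => by
      rw [lintegral_temperedLevyMeasure α _ hF,
        lintegral_representation_eq_temperedJumpIntegral hα hG hU hY hind hF]
    exact ⟨hrep, eq_pathLaw_withDensity_of_lintegral hα0 (aemeasurable_of_coe hG.aemeasurable)
      (aemeasurable_of_coe hU.aemeasurable) (aemeasurable_of_coe hY.aemeasurable) hrep⟩
  · rw [hψ.isCondLawAtZero_iff hα.2] at hκ
    have h : IsLevyMeasure κ (temperedLevyMeasure α (Ioi (a : ℝ))) := by
      rw [hκ]
      exact isLevyMeasure_temperedLevyMeasure hα measurableSet_Ioi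
        (Ioi_subset_Ioi a.coe_nonneg) (hψ.integral_pathExp_future hα0 a)
    refine ⟨h.existsUnique, fun ν hν F hF => ?_⟩
    rw [hν.unique h, lintegral_temperedLevyMeasure α _ hF]
  · rw [hψ.isComplementLaw_iff hα] at hη
    have h : IsLevyMeasure η (temperedLevyMeasure α (Ioc 0 (a : ℝ))) := by
      rw [hη]
      exact isLevyMeasure_temperedLevyMeasure hα measurableSet_Ioc
        Ioc_subset_Ioi_self (hψ.integral_pathExp_past hα0 a)
    refine ⟨h.existsUnique, fun ν hν F hF => ?_⟩
    rw [hν.unique h, lintegral_temperedLevyMeasure α _ hF]
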